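/- Let $R$ be a discrete valuation ring with uniformizer $\pi$, fraction field $K$ and algebraically closed residue field $\kappa$, and let $0<r<d$ be integers. Let $\Gamma=\{[L_v]\}_v$ be a finite set of homothety classes of $R$-lattices in $K^d$, with representatives $L_v$, which is convex: for all representatives $L,L'$ of members of $\Gamma$ one has $[L\cap L']\in\Gamma$. Put $\overline L_v=L_v/\pi L_v$, let $n_{u,v}$ be the least integer with $\pi^{n_{u,v}}L_u\subset L_v$, and let $f_{u,v}\colon\overline L_u\to\overline L_v$ be the map induced by multiplication by $\pi^{n_{u,v}}$. Assume that $\Gamma$ is locally weakly independent: for each $v\in\Gamma$ there is a subset $I_v\subset\Gamma$ such that for each $u\neq v$ one has $f_{u,v}=f_{w,v}\circ f_{u,w}$ for some $w\in I_v$, and such that the subspaces $\operatorname{im}f_{w,v}=\ker f_{v,w}$ of $\overline L_v$, for $w\in I_v$, are linearly independent. Let $Q(\Gamma)$ be the quiver with vertex set $\Gamma$ and one arrow $u\to v$ for each pair $u\neq v$ such that $f_{u,v}$ is not the composite of the maps $f_{w,w'}$ along a path $u=w_0,w_1,\dots,w_m=v$ with $m\geq 2$ and $w_{i}\neq w_{i+1}$.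 The spaces $\overline L_v$ and the maps $f_{u,v}$ form a representation $M_\Gamma$ of $Q(\Gamma)$. A sub-representation of $M_\Gamma$ is called projective if it is a projective object in the category of those representations of $Q(\Gamma)$ over $\kappa$ that satisfy all linear relations between parallel paths that hold in $M_\Gamma$. Let $LG_r(\Gamma)_0$ be the special fiber of the linked Grassmannian. Its ($\kappa$-)points, with the Zariski topology induced from $\prod_v\mathrm{Gr}(r,\overline L_v)$, are the families $M=(U_v)_v$ of $r$-dimensional subspaces $U_v\subset\overline L_v$ such that, whenever $\pi^kL_u\subset L_v$ with $k\in\mathbb Z$, the map $\overline L_u\to\overline L_v$ induced by $\pi^k$ sends $U_u$ into $U_v$; every such $M$ is a sub-representation of $M_\Gamma$. Let $\Phi(M)=(\dim f_{u,v}(U_u))_{u,v}$ be the rank vector of $M$, and let $\mathcal S_M\subset LG_r(\Gamma)_0$ be the set of all points that are isomorphic to $M$ as representations of $Q(\Gamma)$. Then: 1. the points given by projective sub-representations are dense in $LG_r(\Gamma)_0$; 2. a point $M$ of $LG_r(\Gamma)_0$ is projective if and only if $\Phi(M)$ is a maximal element of the set $\{\Phi(N) : N\in LG_r(\Gamma)_0\}$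 with respect to the componentwise order; 3. the irreducible components of $LG_r(\Gamma)_0$ are exactly the closures $\overline{\mathcal S_M}$ of the strata of the projective points $M$, and non-isomorphic projective points give different components. -/

import Mathlib

open CategoryTheory TensorProduct
open scoped Pointwise

universe u w x

namespace LinkedGrassmannian

/-- The residue field `κ` of the discrete valuation ring `R`. -/
abbrev Kappa (R : Type u) [CommRing R] [IsLocalRing R] : Type u := IsLocalRing.ResidueField R

section Configurations

variable {R : Type u} [CommRing R] {K : Type w} [Field K] [Algebra R K] {d : ℕ} {ι : Type x}

/-- Two `R`-submodules of `K ^ d` are homothetic if they differ by a nonzero scalar of `K`. -/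
def Homothetic (L L' : Submodule R (Fin d → K)) : Prop :=
  ∃ a : K, a ≠ 0 ∧ L' = a • L

variable (R K d ι) in
/-- A family, indexed by `ι`, of pairwise distinct homothety classes of lattices in `K ^ d`,
with chosen representatives `L i`. -/
structure Configuration where
  /-- the chosen representatives -/
  L : ι → Submodule R (Fin d → K)
  isLattice : ∀ i, Submodule.IsLattice K (L i)
  eq_of_homothetic : ∀ i j, Homothetic (L i) (L j) → i = j

/-- A configuration is convex if the class of the intersection of any representatives of two
of its members is again a member. -/
def Configuration.IsConvex (Γ : Configuration R K d ι) : Prop :=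
  ∀ (i j : ι) (a b : K), a ≠ 0 → b ≠ 0 → ∃ k, Homothetic (Γ.L k) (a • Γ.L i ⊓ b • Γ.L j)

/-- The (possibly negative) power `ϖ ^ n`, as an element of `K`. -/
def piPow (K : Type w) [Field K] [Algebra R K] (ϖ : R) (n : ℤ) : K := (algebraMap R K ϖ) ^ n

/-- Multiplication by `c ∈ K`, as a map `L → L'` between submodules with `c L ⊆ L'`. -/
def mulMap (c : K) {L L' : Submodule R (Fin d → K)} (h : c • L ≤ L') : L →ₗ[R] L' :=
  (DistribSMul.toLinearMap R (Fin d → K) c).restrict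
    fun v hv => h (Submodule.smul_mem_pointwise_smul v c L hv)

/-- `n i j` is the smallest integer `n` with `ϖ ^ n L i ⊆ L j`. -/
noncomputable def exponent (ϖ : R) (Γ : Configuration R K d ι) (i j : ι) : ℤ :=
  sInf {n : ℤ | piPow K ϖ n • Γ.L i ≤ Γ.L j}

theorem exists_pow_smul_le [IsDomain R] [IsDiscreteValuationRing R] [IsFractionRing R K]
    {ϖ : R} (hϖ : Irreducible ϖ) (L L' : Submodule R (Fin d → K))
    (hL : Submodule.IsLattice K L) (hL' : Submodule.IsLattice K L') :
    ∃ n : ℕ, ∀ y ∈ L, piPow K ϖ n • y ∈ L' := by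
  have hmul : ∀ (n : ℕ) (y : Fin d → K), piPow K ϖ n • y = ϖ ^ n • y := by
    intro n y
    rw [← algebraMap_smul K (ϖ ^ n) y, map_pow]
    simp [piPow]
  simp only [hmul]
  have hpt : ∀ y : Fin d → K, ∃ n : ℕ, ϖ ^ n • y ∈ L' := by
    intro y
    have hy : y ∈ Submodule.span K (L' : Set (Fin d → K)) := by
      rw [hL'.span_eq_top]; trivial
    induction hy using Submodule.span_induction with
    | mem z hz => exact ⟨0, by simpa using hz⟩
    | zero => exact ⟨0, by simp⟩
    | add a b _ _ ha hb =>
      obtain ⟨n, hn⟩ := ha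
      obtain ⟨m, hm⟩ := hb
      refine ⟨n + m, ?_⟩
      rw [smul_add]
      refine L'.add_mem ?_ ?_
      · rw [add_comm, pow_add, mul_smul]; exact L'.smul_mem _ hn
      · rw [pow_add, mul_smul]; exact L'.smul_mem _ hm
    | smul c a _ ha =>
      obtain ⟨n, hn⟩ := ha
      obtain ⟨p, q, hq, rfl⟩ := IsFractionRing.div_surjective (A := R) c
      have hq0 : q ≠ 0 := nonZeroDivisors.ne_zero hq
      obtain ⟨m, v, rfl⟩ := IsDiscreteValuationRing.eq_unit_mul_pow_irreducible hq0 hϖ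
      have hq1 : algebraMap R K ((v : R) * ϖ ^ m) ≠ 0 := by simpa using hq0
      refine ⟨n + m, ?_⟩
      have : ϖ ^ (n + m) • (algebraMap R K p / algebraMap R K (↑v * ϖ ^ m)) • a
          = ((v⁻¹ : Rˣ) * p : R) • (ϖ ^ n • a) := by
        rw [smul_smul _ _ a, ← algebraMap_smul K (ϖ ^ (n + m)), smul_smul,
          ← algebraMap_smul K ((v⁻¹ : Rˣ) * p * ϖ ^ n : R)]
        congr 1
        rw [mul_div_assoc', div_eq_iff hq1, ← map_mul, ← map_mul]
        congr 1
        have : ((v⁻¹ : Rˣ) : R) * v = 1 := by simp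
        linear_combination (-(p * ϖ ^ (n + m))) * this
      rw [this]
      exact L'.smul_mem _ hn
  refine Submodule.fg_induction
    (motive := fun N _ => ∃ n : ℕ, ∀ y ∈ N, ϖ ^ n • y ∈ L') ?_ ?_ L hL.fg
  · intro y
    obtain ⟨n, hn⟩ := hpt y
    refine ⟨n, fun z hz => ?_⟩
    obtain ⟨a, rfl⟩ := Submodule.mem_span_singleton.1 hz
    rw [smul_comm]
    exact L'.smul_mem _ hn
  · rintro N₁ N₂ - - ⟨n, hn⟩ ⟨m, hm⟩
    refine ⟨n + m, fun z hz => ?_⟩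
    obtain ⟨a, ha, b, hb, rfl⟩ := Submodule.mem_sup.1 hz
    rw [smul_add]
    refine L'.add_mem ?_ ?_
    · rw [add_comm, pow_add, mul_smul]; exact L'.smul_mem _ (hn _ ha)
    · rw [pow_add, mul_smul]; exact L'.smul_mem _ (hm _ hb)

/-- The integer `exponent ϖ Γ i j` really is the least one (when `d > 0`). -/
theorem exponent_isLeast [IsDomain R] [IsDiscreteValuationRing R] [IsFractionRing R K]
    {ϖ : R} (hϖ : Irreducible ϖ) (hd : 0 < d) (Γ : Configuration R K d ι) (i j : ι) :
    IsLeast {n : ℤ | piPow K ϖ n • Γ.L i ≤ Γ.L j} (exponent ϖ Γ i j) := by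
  obtain ⟨n, hn⟩ := exists_pow_smul_le hϖ (Γ.L i) (Γ.L j) (Γ.isLattice i) (Γ.isLattice j)
  obtain ⟨m, hm⟩ := exists_pow_smul_le hϖ (Γ.L j) (Γ.L i) (Γ.isLattice j) (Γ.isLattice i)
  have hne : {n : ℤ | piPow K ϖ n • Γ.L i ≤ Γ.L j}.Nonempty :=
    ⟨n, fun y hy => by
      obtain ⟨z, hz, rfl⟩ := (Submodule.mem_smul_pointwise_iff_exists _ _ _).1 hy
      exact hn z hz⟩
  have h0 : algebraMap R K ϖ ≠ 0 := by
    simpa using hϖ.ne_zero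
  have hbdd : BddBelow {n : ℤ | piPow K ϖ n • Γ.L i ≤ Γ.L j} := by
    refine ⟨-(m : ℤ), fun k hk => ?_⟩
    by_contra! hlt
    obtain ⟨e, he⟩ : ∃ e : ℕ, -(m : ℤ) - k = e + 1 := ⟨(-(m : ℤ) - k - 1).toNat, by omega⟩
    have key : ∀ y ∈ Γ.L i, y ∈ Ideal.span {ϖ} • Γ.L i := by
      intro y hy
      have h1 : piPow K ϖ m • piPow K ϖ k • y ∈ Γ.L i :=
        hm _ (hk (Submodule.smul_mem_pointwise_smul y _ _ hy))
      have h2 : y = ϖ • (ϖ ^ e • (piPow K ϖ m • piPow K ϖ k • y)) := by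
        rw [smul_smul ϖ, ← pow_succ', smul_smul (piPow K ϖ m),
          ← algebraMap_smul K (ϖ ^ (e + 1)), smul_smul]
        have : algebraMap R K (ϖ ^ (e + 1)) * (piPow K ϖ m * piPow K ϖ k) = 1 := by
          unfold piPow
          rw [map_pow, ← zpow_natCast, ← zpow_add₀ h0, ← zpow_add₀ h0]
          have : ((e + 1 : ℕ) : ℤ) + ((m : ℤ) + k) = 0 := by push_cast; omega
          rw [this, zpow_zero]
        rw [this, one_smul]
      rw [h2]
      exact Submodule.smul_mem_smul (Ideal.mem_span_singleton_self ϖ)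
        ((Γ.L i).smul_mem _ h1)
    have hbot : Γ.L i = ⊥ := by
      refine Submodule.eq_bot_of_le_smul_of_le_jacobson_bot (Ideal.span {ϖ}) _
        (Γ.isLattice i).fg key ?_
      rw [IsLocalRing.jacobson_eq_maximalIdeal ⊥ bot_ne_top, hϖ.maximalIdeal_eq]
    have htop := (Γ.isLattice i).span_eq_top
    rw [hbot] at htop
    have : Nonempty (Fin d) := ⟨⟨0, hd⟩⟩
    simp at htop
  exact ⟨Int.csInf_mem hne hbdd, fun k hk => csInf_le hbdd hk⟩

open Classical in
/-- The map `F i j : L i → L j`, multiplication by `ϖ ^ n i j`. (By `exponent_isLeast` the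
second case does not occur.) -/
noncomputable def bigF (ϖ : R) (Γ : Configuration R K d ι) (i j : ι) : Γ.L i →ₗ[R] Γ.L j :=
  if h : piPow K ϖ (exponent ϖ Γ i j) • Γ.L i ≤ Γ.L j then
    mulMap (piPow K ϖ (exponent ϖ Γ i j)) h
  else 0

variable [IsLocalRing R]

/-- The reduction `κ ⊗ L i`, canonically `L i / ϖ L i`. -/
abbrev Configuration.Lbar (Γ : Configuration R K d ι) (i : ι) : Type (max u w) :=
  Kappa R ⊗[R] Γ.L i

/-- The map `f i j` between the reductions of `L i` and `L j` induced by `F i j`. -/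
noncomputable def smallF (ϖ : R) (Γ : Configuration R K d ι) (i j : ι) :
    Γ.Lbar i →ₗ[Kappa R] Γ.Lbar j :=
  (bigF ϖ Γ i j).baseChange (Kappa R)

/-- Local weak independence at `v`. (The equality of image and kernel excludes `v ∈ I`.) -/
def IsLocallyWeaklyIndependentAt (ϖ : R) (Γ : Configuration R K d ι) (v : ι) : Prop :=
  ∃ I : Set ι,
    (∀ u, u ≠ v → ∃ w ∈ I, smallF ϖ Γ u v = smallF ϖ Γ w v ∘ₗ smallF ϖ Γ u w) ∧
    (∀ w ∈ I, LinearMap.range (smallF ϖ Γ w v) = LinearMap.ker (smallF ϖ Γ v w)) ∧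
    iSupIndep fun w : I => LinearMap.range (smallF ϖ Γ w v)

/-- Locally weakly independent lattice configurations. -/
structure IsLocallyWeaklyIndependent (ϖ : R) (Γ : Configuration R K d ι) : Prop where
  convex : Γ.IsConvex
  indep : ∀ v, IsLocallyWeaklyIndependentAt ϖ Γ v

/-! ### The quiver of a configuration and its representations -/

/-- The vertices of the quiver `Q'`, which has exactly one arrow `i ⟶ j` for all `i ≠ j`. -/
def FullVertex (_ : Configuration R K d ι) : Type x := ι

instance (Γ : Configuration R K d ι) : Quiver (FullVertex Γ) where
  Hom i j := PLift (i ≠ j)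

/-- The composite of the maps `f` along a path of `Q'`. -/
noncomputable def pathMap (ϖ : R) (Γ : Configuration R K d ι) (i : ι) :
    (j : ι) → Quiver.Path (V := FullVertex Γ) i j → (Γ.Lbar i →ₗ[Kappa R] Γ.Lbar j)
  | _, .nil => LinearMap.id
  | _, .cons (b := b) (c := c) p _ => smallF ϖ Γ b c ∘ₗ pathMap ϖ Γ i b p

/-- The vertices of the quiver `Q` of the configuration. -/
def Vertex (_ : R) (_ : Configuration R K d ι) : Type x := ι

/-- The arrows of `Q` are those arrows `i ⟶ j` of `Q'` for which `f i j` is not the composite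
along a path of `Q'` of length at least two. -/
instance (ϖ : R) (Γ : Configuration R K d ι) : Quiver (Vertex ϖ Γ) where
  Hom i j := PLift (i ≠ j ∧
    ¬ ∃ p : Quiver.Path (V := FullVertex Γ) i j, 2 ≤ p.length ∧ pathMap ϖ Γ i j p = smallF ϖ Γ i j)

/-- Representations of the quiver `Q` over `κ`. -/
abbrev QuiverRep (ϖ : R) (Γ : Configuration R K d ι) :=
  Paths (Vertex ϖ Γ) ⥤ ModuleCat.{max u w} (Kappa R)

/-- The representation `M_Γ`, formed by the reductions of the lattices and the maps `f i j`. -/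
noncomputable def ambientRep (ϖ : R) (Γ : Configuration R K d ι) : QuiverRep ϖ Γ :=
  Paths.lift
    { obj := fun i => ModuleCat.of (Kappa R) (Γ.Lbar i)
      map := fun {i j} _ => ModuleCat.ofHom (smallF ϖ Γ i j) }

/-- A representation satisfies the relations of `M_Γ` if every linear combination of parallel
paths that acts as zero on `M_Γ` acts as zero on it. -/
def satisfiesRelations (ϖ : R) (Γ : Configuration R K d ι) : ObjectProperty (QuiverRep ϖ Γ) :=
  fun N => ∀ (i j : Paths (Vertex ϖ Γ)) (c : (i ⟶ j) →₀ Kappa R),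
    (c.sum fun p a => a • (ambientRep ϖ Γ).map p) = 0 → (c.sum fun p a => a • N.map p) = 0

/-- The category of representations of the bound quiver (`Q` with the relations of `M_Γ`). -/
abbrev BoundRep (ϖ : R) (Γ : Configuration R K d ι) := (satisfiesRelations ϖ Γ).FullSubcategory

/-! ### The special fiber of the linked Grassmannian -/

/-- A `κ`-point of the special fiber of the linked Grassmannian `LG_r(Γ)`: for every `i` an
`r`-dimensional subspace `E i` of `κ ⊗ L i`, such that for every inclusion
`ϖ ^ k : L i → L j` (`k` any integer) the induced map sends `E i` into `E j`. -/
@[ext]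
structure SpecialFiber (ϖ : R) (Γ : Configuration R K d ι) (r : ℕ) where
  /-- the subspaces -/
  E : ∀ i, Submodule (Kappa R) (Γ.Lbar i)
  finrank_eq : ∀ i, Module.finrank (Kappa R) (E i) = r
  compat : ∀ (i j : ι) (k : ℤ) (h : piPow K ϖ k • Γ.L i ≤ Γ.L j),
    ∀ y ∈ E i, (mulMap (piPow K ϖ k) h).baseChange (Kappa R) y ∈ E j

namespace SpecialFiber

variable {ϖ : R} {Γ : Configuration R K d ι} {r : ℕ}

theorem smallF_mem (M : SpecialFiber ϖ Γ r) (i j : ι) (y : Γ.Lbar i) (hy : y ∈ M.E i) :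
    smallF ϖ Γ i j y ∈ M.E j := by
  unfold smallF bigF
  split_ifs with h
  · exact M.compat i j _ h y hy
  · simp

/-- The sub-representation of `M_Γ` given by a point of the special fiber. -/
noncomputable def rep (M : SpecialFiber ϖ Γ r) : QuiverRep ϖ Γ :=
  Paths.lift
    { obj := fun i => ModuleCat.of (Kappa R) (M.E i)
      map := fun {i j} _ => ModuleCat.ofHom ((smallF ϖ Γ i j).restrict (M.smallF_mem i j)) }

/-- The inclusion of a sub-representation into `M_Γ`. -/
noncomputable def incl (M : SpecialFiber ϖ Γ r) : M.rep ⟶ ambientRep ϖ Γ :=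
  Paths.liftNatTrans (fun i => ModuleCat.ofHom (M.E i).subtype) fun {i j} e => by
    simp only [rep, ambientRep, Paths.lift_toPath]
    rfl

theorem satisfiesRelations_rep (M : SpecialFiber ϖ Γ r) : satisfiesRelations ϖ Γ M.rep := by
  intro i j c hc
  have hmono : Mono (M.incl.app j) :=
    (ModuleCat.mono_iff_injective _).2 (M.E j).injective_subtype
  rw [← cancel_mono (M.incl.app j), Limits.zero_comp, Finsupp.sum, Preadditive.sum_comp]
  simp only [Linear.smul_comp, NatTrans.naturality]
  simp only [← Linear.comp_smul]
  rw [← Preadditive.comp_sum]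
  rw [Finsupp.sum] at hc
  rw [hc, Limits.comp_zero]

/-- The sub-representation given by a point, as a representation with relations. -/
noncomputable def boundRep (M : SpecialFiber ϖ Γ r) : BoundRep ϖ Γ :=
  ⟨M.rep, M.satisfiesRelations_rep⟩

/-- The point is projective: its sub-representation is a projective object of the category of
representations of `Q` satisfying the relations of `M_Γ`. -/
def IsProjective (M : SpecialFiber ϖ Γ r) : Prop := Projective M.boundRep

/-- The rank vector `(dim f i j (E i))` of a point. -/
noncomputable def rankVector (M : SpecialFiber ϖ Γ r) : ι → ι → ℕ :=
  fun i j => Module.finrank (Kappa R) ((M.E i).map (smallF ϖ Γ i j))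

/-- The quiver stratum of `M`: all points whose sub-representation is isomorphic to that of
`M`. -/
def stratum (M : SpecialFiber ϖ Γ r) : Set (SpecialFiber ϖ Γ r) :=
  {N | Nonempty (N.rep ≅ M.rep)}

variable (ϖ Γ r) in
/-- Points of the special fiber together with a basis of each of the subspaces. Over the
special fiber this is a Zariski locally trivial principal bundle with group `∏ i, GL_r`. -/
structure Framed where
  /-- the underlying point of the special fiber -/
  point : SpecialFiber ϖ Γ r
  /-- the bases of the subspaces -/
  basis : ∀ i, Module.Basis (Fin r) (Kappa R) (point.E i)

/-- All the linear coordinates of a framed point: the values of all linear forms on `κ ⊗ L i`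
at the vectors of the basis of `E i`. -/
noncomputable def Framed.coord (b : Framed ϖ Γ r) :
    (Σ i, Fin r × Module.Dual (Kappa R) (Γ.Lbar i)) → Kappa R :=
  fun s => s.2.2 (b.basis s.1 s.2.1)

/-- The Zariski topology on the space of framed points, a locally closed subset of the
affine space `∏ i, (κ ⊗ L i) ^ r`: the closed sets are the zero loci of polynomials in the
linear coordinates. -/
noncomputable instance : TopologicalSpace (Framed ϖ Γ r) :=
  TopologicalSpace.induced
    (fun b => (MvPolynomial.pointToPoint (k := Kappa R) b.coord :
      PrimeSpectrum (MvPolynomial _ (Kappa R)))) inferInstance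

/-- The Zariski topology on the special fiber, a closed subvariety of the product of the
Grassmannians `Gr(r, κ ⊗ L i)`: the quotient topology from the space of framed points. -/
noncomputable instance : TopologicalSpace (SpecialFiber ϖ Γ r) :=
  TopologicalSpace.coinduced Framed.point inferInstance

/-- Explicit form of the topology: a set of points is closed if and only if membership in it is
given by the vanishing of polynomials in the coordinates of a basis of the subspaces. -/
theorem isClosed_iff (Z : Set (SpecialFiber ϖ Γ r)) :
    IsClosed Z ↔ ∃ S : Set (MvPolynomial
        (Σ i, Fin r × Module.Dual (Kappa R) (Γ.Lbar i)) (Kappa R)),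
      ∀ b : Framed ϖ Γ r, b.point ∈ Z ↔ ∀ p ∈ S, MvPolynomial.eval b.coord p = 0 := by
  rw [isClosed_coinduced, isClosed_induced_iff]
  constructor
  · rintro ⟨t, ht, h⟩
    obtain ⟨s, rfl⟩ := (PrimeSpectrum.isClosed_iff_zeroLocus _).1 ht
    refine ⟨s, fun b => ?_⟩
    have := Set.ext_iff.1 h b
    simp only [Set.mem_preimage] at this
    rw [← this]
    simp [PrimeSpectrum.mem_zeroLocus, MvPolynomial.pointToPoint, Set.subset_def,
      MvPolynomial.mem_vanishingIdeal_iff, MvPolynomial.aeval_eq_eval]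
  · rintro ⟨s, h⟩
    refine ⟨PrimeSpectrum.zeroLocus s, PrimeSpectrum.isClosed_zeroLocus s, ?_⟩
    ext b
    simp [h, PrimeSpectrum.mem_zeroLocus, MvPolynomial.pointToPoint, Set.subset_def,
      MvPolynomial.mem_vanishingIdeal_iff, MvPolynomial.aeval_eq_eval]

end SpecialFiber

end Configurations

end LinkedGrassmannian

/-!
Call a path shortest if the exponents `n u v` are additive along it. As `Γ` is convex and locally
weakly independent, `n u v + n v u = 1` along arrows, so that `f u v` and `f v u` are exact in both
directions, and the last arrow of a shortest path is determined by the endpoints of the path.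

A point which is exact at all arrows is free: vectors which form a basis modulo the images of the
arrows generate it by Nakayama's lemma, and their nonzero images form a basis at each vertex. Hence
exact points are projective. Conversely a projective point is a direct summand of a free
representation, and exactness passes to direct summands.

If a point is not exact, follow a violation of exactness backwards until it lies on a cycle. The
endomorphisms `1 + s • φ`, where `φ` has rank at most one at each vertex and is supported beyond the
violation, deform the point along a line in `LG_r(Γ)₀`, whose general member has a strictly larger
rank vector. So the projective points are dense, by induction on the rank vector, and they are the
points with maximal rank vector. The points generated by generators of a given type are joined by
lines of generators, so they form an irreducible stratum, and as rank vectors are lower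
semicontinuous, the stratum of a projective point is open.
-/

namespace LinkedGrassmannian

/-! ### Exponent systems -/

section ExponentSystems

variable {ι : Type*} {n : ι → ι → ℤ} {I : ι → Set ι}

/-- The vertex `v` lies between `u` and `w`: the exponents `n` are additive along `u, v, w`, so
that a shortest path from `u` to `w` may be taken through `v`. -/
abbrev Between (n : ι → ι → ℤ) (u v w : ι) : Prop := n u w = n u v + n v w

/-- Integers `n u v` with the formal properties of the exponents of a lattice configuration. -/
structure IsExponentSystem (n : ι → ι → ℤ) : Prop where
  self : ∀ u, n u u = 0
  triangle : ∀ u v w, n u w ≤ n u v + n v w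
  pos : ∀ {u v}, u ≠ v → 0 < n u v + n v u

/-- The combinatorial form of convexity: `i`, shifted by `s`, is the largest vertex which is
contained both in `v` and in `w` shifted by `m`. -/
def HasInf (n : ι → ι → ℤ) : Prop :=
  ∀ v w m, ∃ i s, n i v ≤ s ∧ n i w ≤ s - m ∧ ∀ u t, n u v ≤ t → n u w ≤ t - m → n u i ≤ t - s

/-- An exponent system with the formal properties of a locally weakly independent configuration;
`I v` is the set of the sources of the arrows with target `v`. -/
structure IsArrowSystem (n : ι → ι → ℤ) (I : ι → Set ι) : Prop extends IsExponentSystem n where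
  exists_pred : ∀ {u v}, u ≠ v → ∃ w ∈ I v, Between n u w v
  pred_unique : ∀ {u v w w'}, w ∈ I v → w' ∈ I v → Between n u w v → Between n u w' v → w = w'
  adjacent : ∀ {v w}, w ∈ I v → n w v + n v w = 1

/-- A cycle `v ⟶ ⋯ ⟶ h ⟶ i ⟶ ⋯ ⟶ j ⟶ v` in which `h ⟶ i` and `j ⟶ v` are arrows, and in which
the paths from `v` to `i` and from `i` to `v` are shortest ones. -/
structure IsCycle (n : ι → ι → ℤ) (I : ι → Set ι) (v h i j : ι) : Prop where
  mem_left : h ∈ I i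
  mem_right : j ∈ I v
  between_left : Between n v h i
  between_right : Between n v i j
  add_eq_one : n i v + n v i = 1

namespace IsExponentSystem

theorem between_left (hn : IsExponentSystem n) (u v : ι) : Between n u u v := by
  simp [hn.self]

theorem between_right (hn : IsExponentSystem n) (u v : ι) : Between n u v v := by
  simp [hn.self]

theorem eq_of_add_nonpos (hn : IsExponentSystem n) {u v : ι} (huv : n u v + n v u ≤ 0) : u = v := by
  by_contra hne
  exact (hn.pos hne).not_ge huv

theorem eq_of_between (hn : IsExponentSystem n) {u v : ι} (huv : Between n u v u) : u = v :=
  hn.eq_of_add_nonpos (by linarith [hn.self u])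

theorem eq_of_between_left (hn : IsExponentSystem n) {u v w : ι} (hv : Between n u v w)
    (hw : Between n v u w) : u = v :=
  hn.eq_of_add_nonpos (by omega)

theorem eq_of_between_right (hn : IsExponentSystem n) {u v w : ι} (hv : Between n u v w)
    (hw : Between n u w v) : v = w :=
  hn.eq_of_add_nonpos (by omega)

theorem between_trans_left (hn : IsExponentSystem n) {w x y z : ι} (hy : Between n w y z)
    (hx : Between n w x y) : Between n w x z := by
  have := hn.triangle w x z
  have := hn.triangle x y z
  omega

theorem between_trans_right (hn : IsExponentSystem n) {w x y z : ι} (hx : Between n w x z)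
    (hy : Between n x y z) : Between n w y z := by
  have := hn.triangle w y z
  have := hn.triangle w x y
  omega

theorem between_trans_left_right (hn : IsExponentSystem n) {w x y z : ι} (hy : Between n w y z)
    (hx : Between n w x y) : Between n x y z := by
  have := hn.triangle w x z
  have := hn.triangle x y z
  omega

theorem between_trans_right_left (hn : IsExponentSystem n) {w x y z : ι} (hx : Between n w x z)
    (hy : Between n x y z) : Between n w x y := by
  have := hn.triangle w y z
  have := hn.triangle w x y
  omega

theorem between_or_between_to (hn : IsExponentSystem n) {a b : ι} (hab : n a b + n b a = 1)
    (z : ι) : Between n z a b ∨ Between n z b a := by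
  have := hn.triangle z a b
  have := hn.triangle z b a
  omega

theorem between_or_between_from (hn : IsExponentSystem n) {a b : ι} (hab : n a b + n b a = 1)
    (z : ι) : Between n a b z ∨ Between n b a z := by
  have := hn.triangle a b z
  have := hn.triangle b a z
  omega

theorem induction_from [Finite ι] (hn : IsExponentSystem n) (z : ι) {motive : ι → Prop}
    (step : ∀ p, (∀ w, w ≠ p → Between n z w p → motive w) → motive p) (p : ι) : motive p := by
  have : IsTrans ι fun w p => w ≠ p ∧ Between n z w p := by
    refine ⟨fun a b c hab hbc => ⟨?_, hn.between_trans_left hbc.2 hab.2⟩⟩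
    rintro rfl
    exact hab.1 (hn.eq_of_between_right hab.2 hbc.2)
  have : Std.Irrefl fun w p => w ≠ p ∧ Between n z w p := ⟨fun a ha => ha.1 rfl⟩
  exact (Finite.wellFounded_of_trans_of_irrefl fun w p => w ≠ p ∧ Between n z w p).induction p
    fun p ih => step p fun w hw hp => ih w ⟨hw, hp⟩

theorem induction_to [Finite ι] (hn : IsExponentSystem n) (z : ι) {motive : ι → Prop}
    (step : ∀ p, (∀ w, w ≠ p → Between n w p z → motive w) → motive p) (p : ι) : motive p := by
  have : IsTrans ι fun w p => w ≠ p ∧ Between n w p z := by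
    refine ⟨fun a b c hab hbc => ⟨?_, hn.between_trans_right hab.2 hbc.2⟩⟩
    rintro rfl
    exact hab.1 (hn.eq_of_between_left hab.2 hbc.2)
  have : Std.Irrefl fun w p => w ≠ p ∧ Between n w p z := ⟨fun a ha => ha.1 rfl⟩
  exact (Finite.wellFounded_of_trans_of_irrefl fun w p => w ≠ p ∧ Between n w p z).induction p
    fun p ih => step p fun w hw hp => ih w ⟨hw, hp⟩

/-- Otherwise, the infimum of `v` and of the largest proper shift of `w` containing `v` would be
different from `v`, and all its ways to `v` would pass through `w`, which is impossible. -/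
theorem add_eq_one_of_hasInf (hn : IsExponentSystem n) (hinf : HasInf n) {J : Set ι} {v w : ι}
    (hpred : ∀ {u}, u ≠ v → ∃ w ∈ J, Between n u w v)
    (huniq : ∀ {u w w'}, w ∈ J → w' ∈ J → Between n u w v → Between n u w' v → w = w')
    (hw : w ∈ J) (hwv : w ≠ v) : n w v + n v w = 1 := by
  obtain ⟨i, s, hiv, hiw, hi⟩ := hinf v w (n w v - 1)
  have hpos := hn.pos hwv
  have hselfw := hn.self w
  have hselfv := hn.self v
  have hwi : n w i ≤ n w v - s := hi w (n w v) le_rfl (by omega)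
  have hwiv : Between n w i v := by
    have := hn.triangle w i v
    omega
  have hs : n i v = s := by
    have := hn.triangle w i v
    omega
  by_cases hne : i = v
  · subst hne
    omega
  obtain ⟨w', hw', hiw'v⟩ := hpred hne
  obtain rfl : w' = w :=
    huniq hw' hw (hn.between_trans_right hwiv hiw'v) (hn.between_left w v)
  have := hi v (n v w' + n w' v - 1) (by omega) (by omega)
  have := hn.triangle v i w'
  omega

end IsExponentSystem

namespace IsArrowSystem

theorem ne_of_mem (hn : IsArrowSystem n I) {v w : ι} (hw : w ∈ I v) : w ≠ v := by
  rintro rfl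
  have := hn.adjacent hw
  have := hn.self w
  omega

theorem chain [Finite ι] (hn : IsArrowSystem n I) {z a b p : ι} (ha : Between n z a p)
    (hb : Between n z b p) : Between n a b p ∨ Between n b a p := by
  revert ha hb
  induction p using hn.induction_from z with
  | step p ih =>
    intro ha hb
    rcases eq_or_ne a p with rfl | hap
    · exact .inr (hn.between_right b a)
    rcases eq_or_ne b p with rfl | hbp
    · exact .inl (hn.between_right a b)
    obtain ⟨w, hw, hwa⟩ := hn.exists_pred hap
    obtain ⟨w', hw', hwb⟩ := hn.exists_pred hbp
    have hzw := hn.between_trans_right ha hwa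
    obtain rfl := hn.pred_unique hw hw' hzw (hn.between_trans_right hb hwb)
    exact (ih w (hn.ne_of_mem hw) hzw (hn.between_trans_right_left ha hwa)
      (hn.between_trans_right_left hb hwb)).imp (hn.between_trans_left hwa)
      (hn.between_trans_left hwb)

theorem eq_or_eq_of_between (hn : IsArrowSystem n I) {a b q : ι} (ha : a ∈ I b)
    (hq : Between n a q b) : q = a ∨ q = b := by
  by_contra! hne
  obtain ⟨c, hc, hqc⟩ := hn.exists_pred hne.2
  obtain rfl := hn.pred_unique hc ha (hn.between_trans_right hq hqc) (hn.between_left a b)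
  exact hne.1 (hn.eq_of_between_left hqc hq)

open Classical in
theorem sum_ite_between [Fintype ι] (hn : IsArrowSystem n I) {M : Type*} [AddCommMonoid M]
    (u v : ι) (x : M) :
    (∑ w with w ∈ I v, if Between n u w v then x else 0) = if u = v then 0 else x := by
  rw [← Finset.sum_filter, Finset.filter_filter]
  split_ifs with huv
  · subst huv
    refine Finset.sum_eq_zero fun w hw => absurd ?_ (hn.ne_of_mem (Finset.mem_filter.1 hw).2.1)
    exact (hn.eq_of_between (Finset.mem_filter.1 hw).2.2).symm
  · obtain ⟨w, hw, huw⟩ := hn.exists_pred huv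
    rw [Finset.sum_eq_single_of_mem w
      (Finset.mem_filter.2 ⟨Finset.mem_univ w, hw, huw⟩)]
    intro w' hw' hne
    simp only [Finset.mem_filter, Finset.mem_univ, true_and] at hw'
    exact absurd (hn.pred_unique hw'.1 hw hw'.2 huw) hne

end IsArrowSystem

namespace IsCycle

variable {v h i j : ι}

theorem between_source_right (C : IsCycle n I v h i j) (hn : IsExponentSystem n) :
    Between n v h j :=
  hn.between_trans_left C.between_right C.between_left

theorem between_iff (C : IsCycle n I v h i j) (hn : IsExponentSystem n) {z : ι} :
    Between n z h j ↔ Between n z h i ∧ Between n z i j := by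
  have hhij : Between n h i j := hn.between_trans_left_right C.between_right C.between_left
  exact ⟨fun hz => ⟨hn.between_trans_right_left hz hhij, hn.between_trans_right hz hhij⟩,
    fun hz => hn.between_trans_left hz.2 hz.1⟩

theorem between_return_right (C : IsCycle n I v h i j) (hn : IsArrowSystem n I) :
    Between n i j v := by
  have := hn.adjacent C.mem_right
  have := C.add_eq_one
  have := C.between_right
  omega

theorem between_return_left (C : IsCycle n I v h i j) (hn : IsArrowSystem n I) :
    Between n i v h := by
  have := hn.adjacent C.mem_left
  have := C.add_eq_one
  have := C.between_left
  omega

theorem not_adjacent_of_between [Finite ι] (C : IsCycle n I v h i j) (hn : IsArrowSystem n I)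
    {q : ι} (hvq : Between n v i q) (hqh : Between n q h i) (hqj : Between n q i j) :
    n i q + n q i ≠ 1 := by
  intro hiq
  have hne : i ≠ q := by
    rintro rfl
    have := hn.self i
    omega
  have hqv : q ≠ v := by
    rintro rfl
    exact hne (hn.eq_of_between hvq).symm
  have hadj := C.add_eq_one
  rcases hn.between_or_between_to (hn.adjacent C.mem_right) q with hqjv | hqvj
  · have hiqh : Between n i q h := by
      have := hn.adjacent C.mem_left
      omega
    rcases hn.chain (C.between_return_left hn) hiqh with hvqh | hqvh
    · exact hne (hn.eq_of_between_right hvq (hn.between_trans_left C.between_left hvqh))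
    · have hqvi := hn.between_trans_left hqh hqvh
      have hqiv := hn.between_trans_left hqjv hqj
      omega
  · have hiqv : Between n i q v := by
      have := C.between_right
      omega
    rcases hn.chain hiqv (C.between_return_right hn) with hqj' | hjqv
    · exact hn.ne_of_mem C.mem_right (hn.eq_of_between_right hqj' hqvj)
    · rcases hn.eq_or_eq_of_between C.mem_right hjqv with rfl | rfl
      · exact hne (hn.eq_of_between hqj).symm
      · exact hqv rfl

/-- Moving away from `i`, a first vertex `q` violating the claim would lie on the way from `z` to
`i`, hence between `h` and `i`. -/
theorem between [Finite ι] (C : IsCycle n I v h i j) (hn : IsArrowSystem n I) {z u : ι}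
    (hz : Between n z h j) (hu : Between n v i u) : Between n z i u := by
  obtain ⟨hzi, hzj⟩ := (C.between_iff hn.toIsExponentSystem).1 hz
  revert hu
  induction u using hn.induction_from i with
  | step q ih =>
    intro hvq
    rcases eq_or_ne i q with rfl | hiq
    · exact hn.between_right z i
    obtain ⟨p, hp, hipq⟩ := hn.exists_pred hiq
    have hzip := ih p (hn.ne_of_mem hp) hipq (hn.between_trans_right_left hvq hipq)
    rcases hn.between_or_between_to (hn.adjacent hp) z with hzpq | hzqp
    · exact hn.between_trans_left hzpq hzip
    exfalso
    rcases hn.chain hzip hzqp with hiqp | hqip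
    · exact hn.ne_of_mem hp (hn.eq_of_between_right hiqp hipq).symm
    have hzqi := hn.between_trans_right_left hzqp hqip
    have hqhi : Between n q h i := by
      rcases hn.chain hzi hzqi with hhqi | hqhi
      · rcases hn.eq_or_eq_of_between C.mem_left hhqi with rfl | rfl
        · exact hn.between_left q i
        · exact absurd rfl hiq
      · exact hqhi
    refine C.not_adjacent_of_between hn hvq hqhi (hn.between_trans_left_right hzj hzqi) ?_
    have := hn.adjacent hp
    omega

theorem between_of_not_between [Finite ι] (C : IsCycle n I v h i j) (hn : IsArrowSystem n I)
    {z u u' : ι} (hz : Between n z h j) (hu : ¬ Between n v i u) (hu' : Between n v i u')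
    (hzu : Between n z u u') : Between n u h u' := by
  rcases hn.chain hzu (C.between hn hz hu') with huiu' | hiuu'
  · have hzui := hn.between_trans_right_left hzu huiu'
    have hzhi := ((C.between_iff hn.toIsExponentSystem).1 hz).1
    rcases hn.chain hzui hzhi with huhi | hhui
    · exact hn.between_trans_left huiu' huhi
    · rcases hn.eq_or_eq_of_between C.mem_left hhui with rfl | rfl
      · exact hn.between_left u u'
      · exact absurd (hn.between_right v u) hu
  · exact absurd (hn.between_trans_right_left hu' hiuu') hu

end IsCycle

end ExponentSystems

/-! ### Linked systems of vector spaces -/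

section Transitions

variable {k : Type*} [Semiring k] {ι : Type*} {V : ι → Type*} [∀ u, AddCommMonoid (V u)]
  [∀ u, Module k (V u)] {f : ∀ u v, V u →ₗ[k] V v} {n : ι → ι → ℤ}

/-- Maps `f u v` which compose like the reductions of the multiplications by the uniformizer to
the powers `n u v`: the composite through `v` is `f u w` if `v` lies between `u` and `w`, and is
otherwise divisible by the uniformizer, hence zero. -/
structure IsTransition (f : ∀ u v, V u →ₗ[k] V v) (n : ι → ι → ℤ) : Prop where
  map_self : ∀ u y, f u u y = y
  map_map : ∀ u v w y, f v w (f u v y) = if Between n u v w then f u w y else 0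

theorem IsTransition.between_of_eq_comp (hf : IsTransition f n) {u v w : ι} (hne : f u w ≠ 0)
    (h : f u w = f v w ∘ₗ f u v) : Between n u v w := by
  by_contra huvw
  refine hne (LinearMap.ext fun y => ?_)
  rw [h, LinearMap.comp_apply, hf.map_map, if_neg huvw, LinearMap.zero_apply]

theorem IsTransition.eq_of_between_of_iSupIndep (hf : IsTransition f n) {u v w w' : ι}
    (hne : f u v ≠ 0) {J : Set ι} (hJ : iSupIndep fun w : J => LinearMap.range (f w v))
    (hw : w ∈ J) (hw' : w' ∈ J) (h : Between n u w v) (h' : Between n u w' v) : w = w' := by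
  by_contra hww'
  have hdisj : Disjoint (LinearMap.range (f w v)) (LinearMap.range (f w' v)) :=
    hJ.pairwiseDisjoint (i := ⟨w, hw⟩) (j := ⟨w', hw'⟩) fun h => hww' (congrArg Subtype.val h)
  refine hne (LinearMap.ext fun y => Submodule.disjoint_def.1 hdisj _
    ⟨f u w y, ?_⟩ ⟨f u w' y, ?_⟩)
  · rw [hf.map_map, if_pos h]
  · rw [hf.map_map, if_pos h']

variable {σ : Type*} {X : σ → Type*} [∀ s, AddCommMonoid (X s)] [∀ s, Module k (X s)]

/-- The transition maps of the free system with a generator at `src s` for each `s`. At each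
vertex, the component `X s` is spanned by the image of this generator, and the transition from `u`
to `v` kills it unless `u` lies between `src s` and `v`. -/
def cut (k : Type*) [Semiring k] {X : σ → Type*} [∀ s, AddCommMonoid (X s)]
    [∀ s, Module k (X s)] (n : ι → ι → ℤ) (src : σ → ι) (u v : ι) :
    (∀ s, X s) →ₗ[k] (∀ s, X s) :=
  LinearMap.pi fun s => if Between n (src s) u v then LinearMap.proj s else 0

@[simp]
theorem cut_apply (src : σ → ι) (u v : ι) (c : ∀ s, X s) (s : σ) :
    cut k n src u v c s = if Between n (src s) u v then c s else 0 := by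
  simp only [cut, LinearMap.pi_apply]
  split_ifs <;> rfl

theorem IsExponentSystem.isTransition_cut (hn : IsExponentSystem n) (src : σ → ι) :
    IsTransition (V := fun _ => ∀ s, X s) (cut k n src) n where
  map_self u c := by
    ext s
    simp [hn.self]
  map_map u v w c := by
    have hiff (z : ι) : Between n z v w ∧ Between n z u v ↔ Between n u v w ∧ Between n z u w :=
      ⟨fun h => ⟨hn.between_trans_left_right h.1 h.2, hn.between_trans_left h.1 h.2⟩,
        fun h => ⟨hn.between_trans_right h.2 h.1, hn.between_trans_right_left h.2 h.1⟩⟩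
    ext s
    rw [cut_apply, cut_apply, ← ite_and, if_congr (hiff (src s)) rfl rfl, ite_and]
    split_ifs <;> simp_all

variable [Fintype σ] {src : σ → ι}

/-- The linear combinations at the vertex `v` of the images of elements `e s` at the vertices
`src s`. -/
def comb (f : ∀ u v, V u →ₗ[k] V v) (e : ∀ s, V (src s)) (v : ι) : (σ → k) →ₗ[k] V v :=
  Fintype.linearCombination k fun s => f (src s) v (e s)

theorem comb_apply (e : ∀ s, V (src s)) (v : ι) (c : σ → k) :
    comb f e v c = ∑ s, c s • f (src s) v (e s) :=
  rfl

theorem IsTransition.map_comb (hf : IsTransition f n) (e : ∀ s, V (src s)) (u v : ι)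
    (c : σ → k) : f u v (comb f e u c) = comb f e v (cut k n src u v c) := by
  simp [comb_apply, hf.map_map]

end Transitions

section LinkedSystems

variable {k : Type*} [Field k] {ι : Type*} {V : ι → Type*} [∀ u, AddCommGroup (V u)]
  [∀ u, Module k (V u)] {f : ∀ u v, V u →ₗ[k] V v} {n : ι → ι → ℤ} {I : ι → Set ι}
  {U : ∀ u, Submodule k (V u)}

/-- Vector spaces and maps with the formal properties of the reductions of a locally weakly
independent configuration. -/
structure IsLinked (f : ∀ u v, V u →ₗ[k] V v) (n : ι → ι → ℤ) (I : ι → Set ι) : Prop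
    extends IsArrowSystem n I, IsTransition f n where
  exact : ∀ {u v}, n u v + n v u = 1 → ∀ y, f u v y = 0 → ∃ z, f v u z = y
  indep : ∀ v, iSupIndep fun w : I v => LinearMap.range (f w v)
  ne_zero : ∀ u v, f u v ≠ 0

/-- Families of subspaces which are stable under the maps of the system. -/
def IsStable (f : ∀ u v, V u →ₗ[k] V v) (U : ∀ u, Submodule k (V u)) : Prop :=
  ∀ u v, ∀ y ∈ U u, f u v y ∈ U v

/-- Exactness of a stable family of subspaces at the sources of the arrows. -/
def IsExact (f : ∀ u v, V u →ₗ[k] V v) (I : ι → Set ι) (U : ∀ u, Submodule k (V u)) : Prop :=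
  ∀ v, ∀ w ∈ I v, ∀ y ∈ U w, f w v y = 0 → ∃ z ∈ U v, f v w z = y

/-- A system of generators `e` of the family `U`, with `t u` elements at the vertex `u`, such that
their images at each vertex form a basis. -/
structure IsAdapted (f : ∀ u v, V u →ₗ[k] V v) (U : ∀ u, Submodule k (V u)) {t : ι → ℕ}
    (e : ∀ s : (Σ u, Fin (t u)), V s.1) : Prop where
  indep : ∀ v, LinearIndependent k fun s => f s.1 v (e s)
  span : ∀ v, Submodule.span k (Set.range fun s => f s.1 v (e s)) = U v

/-- The radical of the family `U`: at each vertex, the part which comes from other vertices. -/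
def radical (f : ∀ u v, V u →ₗ[k] V v) (I : ι → Set ι) (U : ∀ u, Submodule k (V u)) (v : ι) :
    Submodule k (V v) :=
  ⨆ w : I v, (U w).map (f w v)

/-- Elements of the family `U` whose classes form a basis of its quotient by the radical. -/
structure IsBasisModRadical (f : ∀ u v, V u →ₗ[k] V v) (I : ι → Set ι)
    (U : ∀ u, Submodule k (V u)) {t : ι → ℕ} (e : ∀ s : (Σ u, Fin (t u)), V s.1) : Prop where
  mem : ∀ s, e s ∈ U s.1
  sup_span : ∀ v, radical f I U v ⊔ Submodule.span k (Set.range fun a => e ⟨v, a⟩) = U v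
  indep : ∀ v (c : Fin (t v) → k), ∑ a, c a • e ⟨v, a⟩ ∈ radical f I U v → c = 0

theorem radical_le (hU : IsStable f U) (v : ι) : radical f I U v ≤ U v :=
  iSup_le fun w => Submodule.map_le_iff_le_comap.2 fun y hy => hU w v y hy

theorem comb_mem [Fintype ι] {t : ι → ℕ} {e : ∀ s : (Σ u, Fin (t u)), V s.1} (hU : IsStable f U)
    (he : ∀ s, e s ∈ U s.1) (v : ι) (c : (Σ u, Fin (t u)) → k) : comb f e v c ∈ U v :=
  Submodule.sum_mem _ fun s _ => Submodule.smul_mem _ _ (hU _ _ _ (he s))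

theorem exists_basis_mod {E : Type*} [AddCommGroup E] [Module k E] {A B : Submodule k E}
    [FiniteDimensional k B] (hAB : A ≤ B) :
    ∃ (m : ℕ) (b : Fin m → E), (∀ a, b a ∈ B) ∧ A ⊔ Submodule.span k (Set.range b) = B ∧
      ∀ c : Fin m → k, ∑ a, c a • b a ∈ A → c = 0 := by
  obtain ⟨C, hC⟩ := Submodule.exists_isCompl A
  have := Submodule.finiteDimensional_of_le (S₁ := C ⊓ B) inf_le_right
  let b := Module.finBasis k (C ⊓ B : Submodule k E)
  refine ⟨_, fun a => b a, fun a => (b a).2.2, ?_, fun c hc => ?_⟩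
  · have hspan : Submodule.span k (Set.range fun a => (b a : E)) = C ⊓ B := by
      have := congrArg (Submodule.map (C ⊓ B).subtype) b.span_eq
      rwa [Submodule.map_span, ← Set.range_comp, Submodule.map_subtype_top] at this
    rw [hspan, ← sup_inf_assoc_of_le _ hAB, hC.sup_eq_top, top_inf_eq]
  · have hsum : ((∑ a, c a • b a : (C ⊓ B : Submodule k E)) : E) = ∑ a, c a • (b a : E) := by
      simp
    have hzero : ∑ a, c a • b a = 0 := Subtype.ext <|
      (Submodule.disjoint_def.1 hC.disjoint) _ (hsum ▸ hc) (∑ a, c a • b a).2.1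
    exact funext (Fintype.linearIndependent_iff.1 b.linearIndependent c hzero)

theorem IsStable.exists_isBasisModRadical (hU : IsStable f U) [∀ u, FiniteDimensional k (U u)]
    (I : ι → Set ι) :
    ∃ (t : ι → ℕ) (e : ∀ s : (Σ u, Fin (t u)), V s.1), IsBasisModRadical f I U e := by
  choose t b hmem hsup hindep using fun v => exists_basis_mod (radical_le (I := I) hU v)
  exact ⟨t, fun s => b s.1 s.2, fun s => hmem s.1 s.2, hsup, hindep⟩

namespace IsLinked

theorem isExact_top (H : IsLinked f n I) : IsExact f I fun u => (⊤ : Submodule k (V u)) := by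
  intro v w hw y _ hy
  obtain ⟨z, hz⟩ := H.exact (H.adjacent hw) y hy
  exact ⟨z, trivial, hz⟩

theorem map_map_eq_zero_of_adjacent (H : IsLinked f n I) {u v : ι} (huv : n u v + n v u = 1)
    (y : V u) : f v u (f u v y) = 0 := by
  rw [H.map_map, if_neg]
  have := H.self u
  omega

open Classical in
theorem eq_zero_of_sum_eq_zero [Fintype ι] (H : IsLinked f n I) {v : ι} {y : ∀ u, V u}
    (hy : ∑ w with w ∈ I v, f w v (y w) = 0) {w : ι} (hw : w ∈ I v) : f w v (y w) = 0 := by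
  refine (iSupIndep_iff_finsetSum_eq_zero_imp_eq_zero _).1 (H.indep v) Finset.univ
    (fun w => f w v (y w)) (fun w _ => ⟨_, rfl⟩) ?_ ⟨w, hw⟩ (Finset.mem_univ _)
  rw [← hy, Finset.sum_subtype _ (p := (· ∈ I v)) (by simp)]

end IsLinked

namespace IsBasisModRadical

variable {t : ι → ℕ} {e : ∀ s : (Σ u, Fin (t u)), V s.1}

/-- Nakayama's lemma for the family `U`. -/
theorem span_eq [Finite ι] (he : IsBasisModRadical f I U e) (H : IsLinked f n I)
    (hU : IsStable f U) (v : ι) :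
    Submodule.span k (Set.range fun s => f s.1 v (e s)) = U v := by
  set S := Submodule.span k (Set.range fun s => f s.1 v (e s))
  refine le_antisymm (Submodule.span_le.2 ?_) ?_
  · rintro _ ⟨s, rfl⟩
    exact hU _ _ _ (he.mem s)
  suffices hmap : ∀ u, (U u).map (f u v) ≤ S from
    fun y hy => hmap v ⟨y, hy, H.map_self v y⟩
  intro u
  induction u using H.induction_to v with
  | step u ih =>
    rw [← he.sup_span u, Submodule.map_sup, sup_le_iff, radical, Submodule.map_iSup,
      Submodule.map_span, Submodule.span_le]
    constructor
    · refine iSup_le fun w => ?_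
      rintro _ ⟨_, ⟨y, hy, rfl⟩, rfl⟩
      rw [H.map_map]
      split_ifs with hwuv
      · exact ih w (H.ne_of_mem w.2) hwuv ⟨y, hy, rfl⟩
      · exact Submodule.zero_mem _
    · rintro _ ⟨_, ⟨a, rfl⟩, rfl⟩
      exact Submodule.subset_span ⟨⟨u, a⟩, rfl⟩

variable [Fintype ι]

open Classical in
theorem comb_eq_add_sum (H : IsLinked f n I) (v : ι) (c : (Σ u, Fin (t u)) → k) :
    comb f e v c = ∑ a, c ⟨v, a⟩ • e ⟨v, a⟩ + ∑ w with w ∈ I v, f w v (comb f e w c) := by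
  have hcut : ∑ w with w ∈ I v, cut k n Sigma.fst w v c =
      fun s : (Σ u, Fin (t u)) => if s.1 = v then 0 else c s := by
    ext s
    simp [Finset.sum_apply, H.sum_ite_between]
  have htop : ∑ a, c ⟨v, a⟩ • e ⟨v, a⟩ =
      comb f e v fun s : (Σ u, Fin (t u)) => if s.1 = v then c s else 0 := by
    rw [comb_apply, Fintype.sum_sigma, Fintype.sum_eq_single v fun u hu => by simp [hu]]
    simp [H.map_self]
  simp only [H.map_comb, ← map_sum, hcut, htop, ← map_add]
  congr 1
  ext s
  by_cases hs : s.1 = v <;> simp [hs]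

open Classical in
/-- In a relation at `v`, the coefficients at `v` vanish modulo the radical. The rest is a sum over
the arrows with target `v`, so by independence and exactness it becomes a relation at the source
of each of these arrows. -/
theorem eq_zero_of_comb_eq_zero (he : IsBasisModRadical f I U e) (H : IsLinked f n I)
    (hU : IsStable f U) (hex : IsExact f I U) (s₀ : Σ u, Fin (t u)) (v : ι)
    (c : (Σ u, Fin (t u)) → k) (hc : comb f e v c = 0) : c s₀ = 0 := by
  induction v using H.induction_from s₀.1 generalizing c with
  | step v ih =>
    rw [comb_eq_add_sum H] at hc
    have htop : (fun a => c ⟨v, a⟩) = 0 := by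
      refine he.indep v _ ?_
      rw [eq_neg_of_add_eq_zero_left hc, neg_mem_iff]
      refine Submodule.sum_mem _ fun w hw => ?_
      exact Submodule.mem_iSup_of_mem (p := fun w : I v => (U w).map (f w v))
        ⟨w, (Finset.mem_filter.1 hw).2⟩ ⟨_, comb_mem hU he.mem w c, rfl⟩
    obtain ⟨u₀, a₀⟩ := s₀
    rcases eq_or_ne u₀ v with rfl | hne
    · exact congrFun htop a₀
    obtain ⟨w, hw, hsw⟩ := H.exists_pred hne
    have hsum : ∑ w with w ∈ I v, f w v (comb f e w c) = 0 := by
      simpa [fun a => congrFun htop a] using hc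
    obtain ⟨z, hz, hzw⟩ := hex v w hw _ (comb_mem hU he.mem w c) (H.eq_zero_of_sum_eq_zero hsum hw)
    rw [← he.span_eq H hU v, Submodule.mem_span_range_iff_exists_fun] at hz
    obtain ⟨b, rfl⟩ := hz
    have hrel : comb f e w (c - cut k n Sigma.fst v w b) = 0 := by
      rw [map_sub, ← H.map_comb, ← hzw, comb_apply, sub_self]
    have hnot : ¬ Between n u₀ v w := fun h =>
      H.ne_of_mem hw (H.eq_of_between_right hsw h)
    simpa [hnot] using ih w (H.ne_of_mem hw) hsw _ hrel

end IsBasisModRadical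

theorem IsLinked.exists_isAdapted [Finite ι] (H : IsLinked f n I) (hU : IsStable f U)
    [∀ u, FiniteDimensional k (U u)] (hex : IsExact f I U) :
    ∃ (t : ι → ℕ) (e : ∀ s : (Σ u, Fin (t u)), V s.1), IsAdapted f U e := by
  have := Fintype.ofFinite ι
  obtain ⟨t, e, he⟩ := hU.exists_isBasisModRadical I
  exact ⟨t, e, fun v => Fintype.linearIndependent_iff.2 fun c hc s =>
    he.eq_zero_of_comb_eq_zero H hU hex s v c hc, he.span_eq H hU⟩

end LinkedSystems

/-! ### Ranks -/

section Ranks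

variable {k : Type*} [Field k] {ι : Type*} {V : ι → Type*} [∀ u, AddCommGroup (V u)]
  [∀ u, Module k (V u)] {f : ∀ u v, V u →ₗ[k] V v} {n : ι → ι → ℤ} {I : ι → Set ι}
  {U : ∀ u, Submodule k (V u)}

/-- The rank of the restriction of `f u v` to a family of subspaces. -/
noncomputable def rank (f : ∀ u v, V u →ₗ[k] V v) (U : ∀ u, Submodule k (V u)) (u v : ι) : ℕ :=
  Module.finrank k ((U u).map (f u v))

theorem finrank_map_add_finrank_inf_ker {E F : Type*} [AddCommGroup E] [Module k E]
    [AddCommGroup F] [Module k F] (W : Submodule k E) [FiniteDimensional k W] (g : E →ₗ[k] F) :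
    Module.finrank k (W.map g) + Module.finrank k (W ⊓ LinearMap.ker g : Submodule k E) =
      Module.finrank k W := by
  have h := LinearMap.finrank_range_add_finrank_ker (g.domRestrict W)
  rw [LinearMap.range_domRestrict, LinearMap.ker_domRestrict] at h
  rw [← h, ← Submodule.map_comap_subtype, LinearEquiv.finrank_eq
    (Submodule.equivMapOfInjective W.subtype W.injective_subtype _).symm]

namespace IsLinked

theorem map_le_inf_ker (H : IsLinked f n I) (hU : IsStable f U) {v w : ι}
    (hvw : n v w + n w v = 1) : (U v).map (f v w) ≤ U w ⊓ LinearMap.ker (f w v) := by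
  rintro _ ⟨y, hy, rfl⟩
  exact ⟨hU _ _ _ hy, H.map_map_eq_zero_of_adjacent hvw y⟩

theorem rank_add_rank_of_isExact (H : IsLinked f n I) (hU : IsStable f U)
    [∀ u, FiniteDimensional k (U u)] (hex : IsExact f I U) {v w : ι} (hw : w ∈ I v) :
    rank f U w v + rank f U v w = Module.finrank k (U w) := by
  have hmap : (U v).map (f v w) = U w ⊓ LinearMap.ker (f w v) := by
    refine le_antisymm (H.map_le_inf_ker hU (add_comm (n w v) _ ▸ H.adjacent hw)) ?_
    rintro y ⟨hy, hy0⟩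
    exact hex v w hw y hy hy0
  rw [← finrank_map_add_finrank_inf_ker (U w) (f w v), rank, rank, hmap]

theorem exists_of_finrank_le (H : IsLinked f n I) (hU : IsStable f U)
    [∀ u, FiniteDimensional k (U u)] {v w : ι} (hvw : n v w + n w v = 1)
    (hle : Module.finrank k (U w) ≤ rank f U w v + rank f U v w) {y : V w} (hy : y ∈ U w)
    (hy0 : f w v y = 0) : ∃ z ∈ U v, f v w z = y := by
  rw [← finrank_map_add_finrank_inf_ker (U w) (f w v), rank, rank, add_le_add_iff_left] at hle
  have hmap := Submodule.eq_of_le_of_finrank_le (H.map_le_inf_ker hU hvw) hle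
  have hker : y ∈ U w ⊓ LinearMap.ker (f w v) := ⟨hy, hy0⟩
  rwa [← hmap] at hker

end IsLinked

theorem finrank_range_cut {σ : Type*} [Fintype σ] (src : σ → ι) (u v : ι) :
    Module.finrank k (LinearMap.range (cut (X := fun _ : σ => k) k n src u v)) =
      Fintype.card {s // Between n (src s) u v} := by
  classical
  have hcut : cut (X := fun _ : σ => k) k n src u v =
      (Matrix.diagonal fun s => if Between n (src s) u v then (1 : k) else 0).mulVecLin := by
    ext; simp [Matrix.mulVec_diagonal]
  rw [hcut]
  refine (Matrix.rank_diagonal _).trans (Fintype.card_congr (Equiv.subtypeEquivRight fun s => ?_))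
  simp

namespace IsAdapted

variable {t : ι → ℕ} {e : ∀ s : (Σ u, Fin (t u)), V s.1}

theorem injective_comb [Fintype ι] (he : IsAdapted f U e) (v : ι) :
    Function.Injective (comb f e v) :=
  (he.indep v).fintypeLinearCombination_injective

theorem range_comb [Fintype ι] (he : IsAdapted f U e) (v : ι) :
    LinearMap.range (comb f e v) = U v := by
  rw [← he.span v]
  exact Fintype.range_linearCombination k _

theorem surjective_comb [Fintype ι] (he : IsAdapted f (fun _ => ⊤) e) (v : ι) :
    Function.Surjective (comb f e v) :=
  LinearMap.range_eq_top.1 (he.range_comb v)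

theorem isExact [Finite ι] (he : IsAdapted f U e) (H : IsLinked f n I) : IsExact f I U := by
  have := Fintype.ofFinite ι
  intro v w hw y hy hy0
  rw [← he.range_comb w] at hy
  obtain ⟨c, rfl⟩ := hy
  refine ⟨comb f e v c, he.range_comb v ▸ LinearMap.mem_range_self _ c, ?_⟩
  rw [H.map_comb] at hy0 ⊢
  congr 1
  ext s
  have hcut := congrFun (he.injective_comb v (hy0.trans (map_zero _).symm)) s
  rw [cut_apply] at hcut ⊢
  rcases H.between_or_between_to (H.adjacent hw) s.1 with h | h
  · rw [if_pos h] at hcut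
    simp [hcut]
  · simp [h]

variable [Fintype ι]

theorem finrank_eq (he : IsAdapted f U e) (v : ι) : Module.finrank k (U v) = ∑ u, t u := by
  rw [← he.range_comb v, LinearMap.finrank_range_of_inj (he.injective_comb v)]
  simp

theorem rank_eq (he : IsAdapted f U e) (H : IsLinked f n I) (u v : ι) :
    rank f U u v = ∑ w, if Between n w u v then t w else 0 := by
  have hcomb : f u v ∘ₗ comb f e u = comb f e v ∘ₗ cut k n Sigma.fst u v :=
    LinearMap.ext (H.map_comb e u v)
  rw [rank, ← he.range_comb u, ← LinearMap.range_comp, hcomb, LinearMap.range_comp,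
    ← (Submodule.equivMapOfInjective _ (he.injective_comb v) _).finrank_eq, finrank_range_cut,
    Fintype.card_subtype, Finset.card_filter, Fintype.sum_sigma]
  refine Finset.sum_congr rfl fun w _ => ?_
  split_ifs <;> simp

open Classical in
theorem add_sum_rank (he : IsAdapted f U e) (H : IsLinked f n I) (v : ι) :
    t v + ∑ w with w ∈ I v, rank f U w v = Module.finrank k (U v) := by
  simp only [he.rank_eq H, he.finrank_eq]
  rw [Finset.sum_comm]
  simp only [H.sum_ite_between]
  rw [← Finset.add_sum_erase _ t (Finset.mem_univ v),
    ← Finset.add_sum_erase _ _ (Finset.mem_univ v), if_pos rfl, zero_add]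
  exact congrArg _ (Finset.sum_congr rfl fun u hu => if_neg (Finset.ne_of_mem_erase hu))

omit [Fintype ι] in
/-- By exactness, the ranks along an arrow and back add up to `r`, so neither can increase. -/
theorem of_rank_le [Finite ι] (he : IsAdapted f U e) (H : IsLinked f n I) (hU : IsStable f U)
    {U' : ∀ u, Submodule k (V u)} (hU' : IsStable f U') [∀ u, FiniteDimensional k (U u)]
    [∀ u, FiniteDimensional k (U' u)]
    (hdim : ∀ u, Module.finrank k (U u) = Module.finrank k (U' u))
    (hle : ∀ u v, rank f U u v ≤ rank f U' u v) :
    ∃ e' : ∀ s : (Σ u, Fin (t u)), V s.1, IsAdapted f U' e' := by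
  classical
  have := Fintype.ofFinite ι
  have hadd {v w : ι} (hw : w ∈ I v) := H.rank_add_rank_of_isExact hU (he.isExact H) hw
  have hex' : IsExact f I U' := by
    intro v w hw y hy hy0
    refine H.exists_of_finrank_le hU' (add_comm (n w v) _ ▸ H.adjacent hw) ?_ hy hy0
    rw [← hdim w, ← hadd hw]
    exact add_le_add (hle _ _) (hle _ _)
  have hrank {v w : ι} (hw : w ∈ I v) : rank f U' w v = rank f U w v := by
    have hadd' := H.rank_add_rank_of_isExact hU' hex' hw
    have := hdim w
    have := hadd hw
    have := hle w v
    have := hle v w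
    omega
  obtain ⟨t', e', he'⟩ := H.exists_isAdapted hU' hex'
  obtain rfl : t' = t := by
    funext v
    have hsum' := he'.add_sum_rank H v
    rw [Finset.sum_congr rfl fun w hw => hrank (Finset.mem_filter.1 hw).2, ← hdim v,
      ← he.add_sum_rank H v] at hsum'
    exact Nat.add_right_cancel hsum'
  exact ⟨e', he'⟩

end IsAdapted

end Ranks

/-! ### Deformation of stable families which are not exact -/

section Deformation

variable {k : Type*} [Field k] {ι : Type*} {V : ι → Type*} [∀ u, AddCommGroup (V u)]
  [∀ u, Module k (V u)] {f : ∀ u v, V u →ₗ[k] V v} {n : ι → ι → ℤ} {I : ι → Set ι}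
  {U : ∀ u, Submodule k (V u)} {v h i j : ι} {x ξ : V i}

/-- Linear forms at the vertices `u` such that `i` lies between `v` and `u`. They are compatible
with the maps of the system, vanish on the part of `U` which comes from the other vertices, and
take the value `1` at `x`. (At the other vertices, `l` is arbitrary.) -/
structure IsSeparating (f : ∀ u v, V u →ₗ[k] V v) (n : ι → ι → ℤ) (U : ∀ u, Submodule k (V u))
    (v i : ι) (x : V i) (l : ∀ u, Module.Dual k (V u)) : Prop where
  apply_eq_one : l i x = 1
  apply_map : ∀ {u u'}, Between n v i u → Between n v i u' →
    ∀ y, l u' (f u u' y) = if Between n i u u' then l u y else 0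
  apply_map_eq_zero : ∀ {u u'}, ¬ Between n v i u → Between n v i u' →
    ∀ y ∈ U u, l u' (f u u' y) = 0

namespace IsLinked

/-- Follow the elements of `U` which map to a violation of exactness at `j ⟶ v` backwards, along
the path from `v` to `j`, as long as possible. -/
theorem exists_isCycle [Finite ι] (H : IsLinked f n I) (hne : ¬ IsExact f I U) :
    ∃ v h i j, IsCycle n I v h i j ∧ ∃ x ∈ U i, f j v (f i j x) = 0 ∧
      ∀ z ∈ U h, f h j z ≠ f i j x := by
  simp only [IsExact, not_forall, not_exists, not_and] at hne
  obtain ⟨v, j, hj, y, hy, hy0, hyv⟩ := hne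
  suffices hback : ∀ p, Between n v p j → (∃ x ∈ U p, f p j x = y) →
      ∃ h i, IsCycle n I v h i j ∧ ∃ x ∈ U i, f i j x = y ∧ ∀ z ∈ U h, f h j z ≠ y by
    obtain ⟨h, i, hC, x, hx, rfl, hz⟩ :=
      hback j (H.between_right v j) ⟨y, hy, H.map_self _ _⟩
    exact ⟨v, h, i, j, hC, x, hx, hy0, hz⟩
  intro p
  induction p using H.induction_from v with
  | step p ih =>
    rintro hp ⟨x, hx, hxy⟩
    have hvp : v ≠ p := by
      rintro rfl
      exact hyv x hx hxy
    obtain ⟨h, hh, hvh⟩ := H.exists_pred hvp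
    by_cases hz : ∃ z ∈ U h, f h j z = y
    · exact ih h (H.ne_of_mem hh) hvh (H.between_trans_left hp hvh) hz
    · push Not at hz
      refine ⟨h, p, ⟨hh, hj, hvh, hp, ?_⟩, x, hx, hxy, hz⟩
      have := H.adjacent hj
      have := H.triangle p j v
      have := H.pos hvp
      omega

theorem exists_direction (H : IsLinked f n I) (hU : IsStable f U)
    [∀ u, FiniteDimensional k (U u)] (hvi : n v i + n i v = 1)
    (hdim : Module.finrank k (U i) ≤ Module.finrank k (U v)) (hx : x ∈ U i) (hx0 : f i v x = 0)
    (hxv : ∀ z ∈ U v, f v i z ≠ x) : ∃ ξ : V i, f i v ξ ∈ U v ∧ ∀ z ∈ U i, f i v z ≠ f i v ξ := by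
  by_contra! hcon
  have hker : U v ⊓ LinearMap.ker (f v i) ≤ (U i).map (f i v) := by
    rintro y ⟨hy, hy0⟩
    obtain ⟨ξ, rfl⟩ := H.exact hvi y hy0
    exact hcon ξ hy
  have hle : Module.finrank k (U i) ≤ rank f U i v + rank f U v i := by
    rw [add_comm]
    exact (hdim.trans_eq (finrank_map_add_finrank_inf_ker (U v) (f v i)).symm).trans
      (add_le_add_right (Submodule.finrank_mono hker) _)
  obtain ⟨z, hz, hzx⟩ := H.exists_of_finrank_le hU hvi hle hx hx0
  exact hxv z hz hzx

end IsLinked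

theorem IsAdapted.exists_dual [Fintype ι] {t : ι → ℕ} {e : ∀ s : (Σ u, Fin (t u)), V s.1}
    (he : IsAdapted f (fun _ => ⊤) e) (c : (Σ u, Fin (t u)) → k) :
    ∃ l : ∀ u, Module.Dual k (V u), ∀ u b, l u (comb f e u b) = b ⬝ᵥ c := by
  let E (u : ι) := LinearEquiv.ofBijective (comb f e u)
    ⟨he.injective_comb u, he.surjective_comb u⟩
  refine ⟨fun u => Fintype.linearCombination k c ∘ₗ (E u).symm.toLinearMap, fun u b => ?_⟩
  rw [LinearMap.comp_apply]
  exact congrArg (Fintype.linearCombination k c) ((E u).symm_apply_apply b)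

/-- In terms of adapted generators `e` of the whole system, the forms are supported on those `e s`
whose way to `j` passes through the arrow `h ⟶ i`. -/
theorem IsLinked.exists_dual_of_isCycle [Finite ι] (H : IsLinked f n I)
    [∀ u, FiniteDimensional k (V u)] (C : IsCycle n I v h i j) (μ : Module.Dual k (V j)) :
    ∃ l : ∀ u, Module.Dual k (V u),
      (∀ {u'}, Between n v i u' → ∀ z, l u' (f h u' z) = μ (f h j z)) ∧
      (∀ {u u'}, Between n v i u → Between n v i u' →
        ∀ y, l u' (f u u' y) = if Between n i u u' then l u y else 0) ∧
      ∀ {u u'}, ¬ Between n v i u → Between n v i u' → ¬ Between n u h u' →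
        ∀ y, l u' (f u u' y) = 0 := by
  have := Fintype.ofFinite ι
  obtain ⟨t, e, he⟩ := H.exists_isAdapted (U := fun u => (⊤ : Submodule k (V u)))
    (fun _ _ _ _ => trivial) H.isExact_top
  obtain ⟨l, hl⟩ := he.exists_dual fun s => if Between n s.1 h j then μ (f s.1 j (e s)) else 0
  have hl_map {u u' : ι} (b : (Σ u, Fin (t u)) → k) : l u' (f u u' (comb f e u b)) =
      ∑ s, if Between n s.1 u u' ∧ Between n s.1 h j then b s * μ (f s.1 j (e s)) else 0 := by
    rw [H.map_comb, hl]
    refine Finset.sum_congr rfl fun s _ => ?_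
    rw [cut_apply, ite_and, ite_mul, zero_mul, mul_ite, mul_zero]
  have hmem {u' : ι} (hu' : Between n v i u') {s : ι} (hs : Between n s h j) : Between n s i u' :=
    C.between H.toIsArrowSystem hs hu'
  have hleft {s : ι} (hs : Between n s h j) : Between n s h i :=
    ((C.between_iff H.toIsExponentSystem).1 hs).1
  refine ⟨l, fun {u'} hu' z => ?_, fun {u u'} hu hu' y => ?_, fun {u u'} hu hu' huu' y => ?_⟩
  · obtain ⟨b, rfl⟩ := he.surjective_comb h z
    rw [hl_map, H.map_comb, comb_apply, map_sum]
    refine Finset.sum_congr rfl fun s _ => ?_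
    rw [cut_apply]
    by_cases hs : Between n s.1 h j
    · rw [if_pos ⟨H.between_trans_left (hmem hu' hs) (hleft hs), hs⟩, if_pos hs, map_smul,
        smul_eq_mul]
    · rw [if_neg fun h => hs h.2, if_neg hs, zero_smul, map_zero]
  · obtain ⟨b, rfl⟩ := he.surjective_comb u y
    have hiff {s : ι} : Between n s u u' ∧ Between n s h j ↔ Between n i u u' ∧ Between n s h j :=
      and_congr_left fun hs => by
        have := hmem hu hs
        have := hmem hu' hs
        omega
    rw [hl_map, hl]
    simp only [hiff, dotProduct, mul_ite, mul_zero, ite_and, Finset.sum_ite_irrel,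
      Finset.sum_const_zero]
  · obtain ⟨b, rfl⟩ := he.surjective_comb u y
    rw [hl_map]
    refine Finset.sum_eq_zero fun s _ => if_neg fun hs => huu' ?_
    exact C.between_of_not_between H.toIsArrowSystem hs.2 hu hu' hs.1

theorem IsLinked.exists_isSeparating [Finite ι] (H : IsLinked f n I)
    [∀ u, FiniteDimensional k (V u)] (hU : IsStable f U) (C : IsCycle n I v h i j)
    (hx0 : f j v (f i j x) = 0) (hxh : ∀ z ∈ U h, f h j z ≠ f i j x) :
    ∃ l, IsSeparating f n U v i x l := by
  obtain ⟨μ, hμx, hμ⟩ : ∃ μ : Module.Dual k (V j), μ (f i j x) = 1 ∧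
      ∀ z ∈ U h, μ (f h j z) = 0 := by
    obtain ⟨μ, hμx, hμ⟩ := Submodule.exists_le_ker_of_notMem (p := (U h).map (f h j))
      (v := f i j x) (by rintro ⟨z, hz, hzx⟩; exact hxh z hz hzx)
    refine ⟨(μ (f i j x))⁻¹ • μ, by simp [hμx], fun z hz => ?_⟩
    rw [LinearMap.smul_apply, LinearMap.mem_ker.1 (hμ ⟨z, hz, rfl⟩), smul_zero]
  obtain ⟨l, hlh, hmap, hzero⟩ := H.exists_dual_of_isCycle C μ
  refine ⟨l, ?_, hmap, fun {u u'} hu hu' y hy => ?_⟩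
  · obtain ⟨b, hb⟩ := H.exact (H.adjacent C.mem_right) _ hx0
    have hb' : f h j (f v h b) = f i j x := by
      rw [← hb, H.map_map, if_pos (C.between_source_right H.toIsExponentSystem)]
    have hlx := hmap (H.between_right v i) C.between_right x
    rw [if_pos (H.between_left i j), ← hb', hlh C.between_right, hb', hμx] at hlx
    exact hlx.symm
  · by_cases huu' : Between n u h u'
    · have hfac : f h u' (f u h y) = f u u' y := by rw [H.map_map, if_pos huu']
      rw [← hfac, hlh hu', hμ _ (hU _ _ _ hy)]
    · exact hzero hu hu' huu' y

open Classical in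
/-- The endomorphisms `y ↦ l u y • f i u ξ` at the vertices `u` such that `i` lies between `v` and
`u`. They deform the family `U` into the families of the images of `1 + t • shear`. -/
noncomputable def shear (f : ∀ u v, V u →ₗ[k] V v) (n : ι → ι → ℤ) (v i : ι) (ξ : V i)
    (l : ∀ u, Module.Dual k (V u)) (u : ι) : V u →ₗ[k] V u :=
  if Between n v i u then (l u).smulRight (f i u ξ) else 0

theorem shear_of_between {l : ∀ u, Module.Dual k (V u)} {u : ι} (hu : Between n v i u) (y : V u) :
    shear f n v i ξ l u y = l u y • f i u ξ := by
  rw [shear, if_pos hu, LinearMap.smulRight_apply]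

theorem shear_of_not_between {l : ∀ u, Module.Dual k (V u)} {u : ι} (hu : ¬ Between n v i u)
    (y : V u) : shear f n v i ξ l u y = 0 := by
  rw [shear, if_neg hu, LinearMap.zero_apply]

namespace IsSeparating

variable {l : ∀ u, Module.Dual k (V u)} {u u' : ι}

theorem map_shear (hl : IsSeparating f n U v i x l) (hf : IsTransition f n)
    (hu' : Between n v i u') {y : V u} (hy : y ∈ U u) :
    f u u' (shear f n v i ξ l u y) = shear f n v i ξ l u' (f u u' y) := by
  rw [shear_of_between hu']
  by_cases hu : Between n v i u
  · rw [shear_of_between hu, map_smul, hf.map_map, hl.apply_map hu hu']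
    split_ifs <;> simp
  · rw [shear_of_not_between hu, hl.apply_map_eq_zero hu hu' y hy, map_zero, zero_smul]

theorem injective_one_add_smul_shear (hl : IsSeparating f n U v i x l)
    (hn : IsExponentSystem n) {t : k} (ht : 1 + t * l i ξ ≠ 0) :
    Function.Injective (1 + t • shear f n v i ξ l u : Module.End k (V u)) := by
  rw [injective_iff_map_eq_zero]
  intro y hy
  rw [LinearMap.add_apply, Module.End.one_apply, LinearMap.smul_apply] at hy
  by_cases hu : Between n v i u
  · rw [shear_of_between hu] at hy
    have hly := congrArg (l u) hy
    rw [map_add, map_smul, map_smul, hl.apply_map (hn.between_right v i) hu,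
      if_pos (hn.between_left i u), map_zero, smul_eq_mul, smul_eq_mul] at hly
    have hly0 : l u y = 0 := by
      have : (1 + t * l i ξ) * l u y = 0 := by linear_combination hly
      exact (mul_eq_zero.1 this).resolve_left ht
    rwa [hly0, zero_smul, smul_zero, add_zero] at hy
  · rwa [shear_of_not_between hu, smul_zero, add_zero] at hy

end IsSeparating

theorem IsStable.map_shear_mem {l : ∀ u, Module.Dual k (V u)} {u u' : ι} (hU : IsStable f U)
    (hf : IsTransition f n) (hn : IsExponentSystem n) (hiv : n i v + n v i = 1)
    (hξ : f i v ξ ∈ U v) (hu' : ¬ Between n v i u') (y : V u) :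
    f u u' (shear f n v i ξ l u y) ∈ U u' := by
  by_cases hu : Between n v i u
  · rw [shear_of_between hu, map_smul, hf.map_map]
    refine (U u').smul_mem _ ?_
    split_ifs
    · have hfac : f v u' (f i v ξ) = f i u' ξ := by
        rw [hf.map_map, if_pos ((hn.between_or_between_from hiv u').resolve_right hu')]
      exact hfac ▸ hU _ _ _ hξ
    · exact (U u').zero_mem
  · rw [shear_of_not_between hu, map_zero]
    exact (U u').zero_mem

theorem IsStable.map_one_add_smul_shear {l : ∀ u, Module.Dual k (V u)} (hU : IsStable f U)
    (hf : IsTransition f n) (hn : IsExponentSystem n) (hiv : n i v + n v i = 1)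
    (hl : IsSeparating f n U v i x l) (hξ : f i v ξ ∈ U v) (t : k) :
    IsStable f fun u => (U u).map (1 + t • shear f n v i ξ l u : Module.End k (V u)) := by
  rintro u u' _ ⟨y, hy, rfl⟩
  have hy' := hU u u' y hy
  rw [LinearMap.add_apply, Module.End.one_apply, LinearMap.smul_apply, map_add, map_smul]
  by_cases hu' : Between n v i u'
  · exact ⟨f u u' y, hy', by rw [hl.map_shear hf hu' hy]; rfl⟩
  · refine ⟨f u u' y + t • f u u' (shear f n v i ξ l u y), (U u').add_mem hy'
      ((U u').smul_mem t (hU.map_shear_mem hf hn hiv hξ hu' y)), ?_⟩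
    rw [LinearMap.add_apply, Module.End.one_apply, LinearMap.smul_apply, shear_of_not_between hu',
      smul_zero, add_zero]

/-- The deformation moves `x` out of the kernel of the map from `i` to `v`, and nothing into it. -/
theorem IsSeparating.rank_lt_rank_map {l : ∀ u, Module.Dual k (V u)}
    [FiniteDimensional k (V i)] (hl : IsSeparating f n U v i x l) (hf : IsTransition f n)
    (hn : IsExponentSystem n) (hx : x ∈ U i) (hx0 : f i v x = 0)
    (hξ : ∀ z ∈ U i, f i v z ≠ f i v ξ) {t : k} (ht : t ≠ 0) :
    rank f U i v <
      rank f (fun u => (U u).map (1 + t • shear f n v i ξ l u : Module.End k (V u))) i v := by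
  set g : Module.End k (V i) := 1 + t • shear f n v i ξ l i
  have hg (y : V i) : (f i v ∘ₗ g) y = f i v y + (t * l i y) • f i v ξ := by
    simp only [g, LinearMap.comp_apply, LinearMap.add_apply, Module.End.one_apply,
      LinearMap.smul_apply, map_add, map_smul, shear_of_between (hn.between_right v i),
      hf.map_self, smul_smul]
  have hnmem {c : k} (hc : c ≠ 0) {z : V i} (hz : z ∈ U i) : f i v z + c • f i v ξ ≠ 0 := by
    refine fun h0 => hξ (-c⁻¹ • z) ((U i).smul_mem _ hz) ?_
    rw [map_smul, eq_neg_of_add_eq_zero_left h0, smul_neg, neg_smul, neg_neg, inv_smul_smul₀ hc]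
  have hlt : U i ⊓ LinearMap.ker (f i v ∘ₗ g) < U i ⊓ LinearMap.ker (f i v) := by
    refine lt_of_le_of_ne ?_ fun heq => ?_
    · rintro y ⟨hy, hy0⟩
      rw [SetLike.mem_coe, LinearMap.mem_ker, hg] at hy0
      have hly : t * l i y = 0 := by_contra fun hly => hnmem hly hy hy0
      rw [hly, zero_smul, add_zero] at hy0
      exact ⟨hy, hy0⟩
    · have hxg := (heq ▸ ⟨hx, hx0⟩ : x ∈ U i ⊓ LinearMap.ker (f i v ∘ₗ g)).2
      rw [SetLike.mem_coe, LinearMap.mem_ker, hg, hl.apply_eq_one, mul_one] at hxg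
      exact hnmem ht hx hxg
  have hlt' := Submodule.finrank_lt_finrank_of_lt hlt
  have hfi := finrank_map_add_finrank_inf_ker (U i) (f i v)
  have hgi := finrank_map_add_finrank_inf_ker (U i) (f i v ∘ₗ g)
  change Module.finrank k ((U i).map (f i v)) < Module.finrank k (((U i).map g).map (f i v))
  rw [← Submodule.map_comp]
  omega

theorem IsLinked.exists_deformation [Finite ι] (H : IsLinked f n I)
    [∀ u, FiniteDimensional k (V u)] (hU : IsStable f U)
    (hdim : ∀ u v, Module.finrank k (U u) = Module.finrank k (U v)) (hne : ¬ IsExact f I U) :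
    ∃ (φ : ∀ u, Module.End k (V u)) (c : k) (a b : ι),
      (∀ t : k, 1 + t * c ≠ 0 → ∀ u, Function.Injective (1 + t • φ u : Module.End k (V u))) ∧
      (∀ t : k, IsStable f fun u => (U u).map (1 + t • φ u : Module.End k (V u))) ∧
      ∀ t : k, t ≠ 0 →
        rank f U a b < rank f (fun u => (U u).map (1 + t • φ u : Module.End k (V u))) a b := by
  obtain ⟨v, h, i, j, C, x, hx, hx0, hxh⟩ := H.exists_isCycle hne
  have hxv : f i v x = 0 := by
    rw [← hx0, H.map_map, if_pos (C.between_return_right H.toIsArrowSystem)]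
  obtain ⟨ξ, hξ, hξU⟩ := H.exists_direction hU (by rw [add_comm, C.add_eq_one]) (hdim i v).le hx hxv
    fun z hz hzx => hxh (f v h z) (hU _ _ _ hz) <| by
      rw [← hzx, H.map_map, H.map_map, if_pos C.between_right,
        if_pos (C.between_source_right H.toIsExponentSystem)]
  obtain ⟨l, hl⟩ := H.exists_isSeparating hU C hx0 hxh
  exact ⟨shear f n v i ξ l, l i ξ, i, v,
    fun t ht u => hl.injective_one_add_smul_shear H.toIsExponentSystem ht,
    hU.map_one_add_smul_shear H.toIsTransition H.toIsExponentSystem C.add_eq_one hl hξ,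
    fun t ht => hl.rank_lt_rank_map H.toIsTransition H.toIsExponentSystem hx hxv hξU ht⟩

end Deformation

/-! ### The linked system of a locally weakly independent configuration -/

section PowersOfUniformizer

variable {R : Type u} [CommRing R] {K : Type w} [Field K] [Algebra R K] {ϖ : R} {d : ℕ}

theorem piPow_zero : piPow K ϖ 0 = 1 := zpow_zero _

theorem piPow_natCast_smul (n : ℕ) (y : Fin d → K) : piPow K ϖ n • y = ϖ ^ n • y := by
  rw [← algebraMap_smul K (ϖ ^ n) y, map_pow, piPow, zpow_natCast]

theorem smul_le_iff {c : K} {L L' : Submodule R (Fin d → K)} :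
    c • L ≤ L' ↔ ∀ y ∈ L, c • y ∈ L' := by
  constructor
  · intro h y hy
    exact h (Submodule.smul_mem_pointwise_smul y _ _ hy)
  · rintro h _ ⟨y, hy, rfl⟩
    exact h y hy

variable [FaithfulSMul R K]

theorem piPow_ne_zero (hϖ : ϖ ≠ 0) (n : ℤ) : piPow K ϖ n ≠ 0 :=
  zpow_ne_zero n ((map_ne_zero_iff _ (FaithfulSMul.algebraMap_injective R K)).2 hϖ)

theorem piPow_smul_piPow_smul (hϖ : ϖ ≠ 0) (m n : ℤ) (y : Fin d → K) :
    piPow K ϖ m • piPow K ϖ n • y = piPow K ϖ (m + n) • y := by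
  have h0 : algebraMap R K ϖ ≠ 0 :=
    (map_ne_zero_iff _ (FaithfulSMul.algebraMap_injective R K)).2 hϖ
  rw [smul_smul, piPow, piPow, piPow, zpow_add₀ h0]

theorem smul_piPow_smul (hϖ : ϖ ≠ 0) (n : ℤ) (y : Fin d → K) :
    ϖ • piPow K ϖ n • y = piPow K ϖ (n + 1) • y := by
  rw [add_comm, ← piPow_smul_piPow_smul hϖ, ← Nat.cast_one, piPow_natCast_smul, pow_one]

theorem mem_piPow_smul_iff (hϖ : ϖ ≠ 0) {s : ℤ} {L : Submodule R (Fin d → K)} {y : Fin d → K} :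
    y ∈ piPow K ϖ s • L ↔ piPow K ϖ (-s) • y ∈ L := by
  constructor
  · rintro ⟨z, hz, rfl⟩
    change piPow K ϖ (-s) • piPow K ϖ s • z ∈ L
    rwa [piPow_smul_piPow_smul hϖ, neg_add_cancel, piPow_zero, one_smul]
  · intro hy
    have := Submodule.smul_mem_pointwise_smul _ (piPow K ϖ s) L hy
    rwa [piPow_smul_piPow_smul hϖ, add_neg_cancel, piPow_zero, one_smul] at this

end PowersOfUniformizer

section Exponents

variable {R : Type u} [CommRing R] [IsDomain R] [IsDiscreteValuationRing R]
  {K : Type w} [Field K] [Algebra R K] [IsFractionRing R K] {ϖ : R} {d : ℕ} {ι : Type x}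
  {Γ : Configuration R K d ι}

theorem exponent_le_iff (hϖ : Irreducible ϖ) (hd : 0 < d) {i j : ι} {n : ℤ} :
    exponent ϖ Γ i j ≤ n ↔ ∀ y ∈ Γ.L i, piPow K ϖ n • y ∈ Γ.L j := by
  have hleast := exponent_isLeast hϖ hd Γ i j
  rw [← smul_le_iff]
  refine ⟨fun hn => ?_, fun hn => hleast.2 hn⟩
  obtain ⟨m, rfl⟩ := Int.le.dest hn
  rw [smul_le_iff]
  intro y hy
  rw [add_comm, ← piPow_smul_piPow_smul hϖ.ne_zero, piPow_natCast_smul]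
  exact (Γ.L j).smul_mem _ (smul_le_iff.1 hleast.1 y hy)

theorem piPow_exponent_smul_mem (hϖ : Irreducible ϖ) (hd : 0 < d) {i : ι} (j : ι) {y : Fin d → K}
    (hy : y ∈ Γ.L i) : piPow K ϖ (exponent ϖ Γ i j) • y ∈ Γ.L j :=
  (exponent_le_iff hϖ hd).1 le_rfl y hy

theorem isExponentSystem_exponent (hϖ : Irreducible ϖ) (hd : 0 < d)
    (Γ : Configuration R K d ι) : IsExponentSystem (exponent ϖ Γ) := by
  have htriangle (i j l : ι) : exponent ϖ Γ i l ≤ exponent ϖ Γ i j + exponent ϖ Γ j l := by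
    rw [exponent_le_iff hϖ hd]
    intro y hy
    rw [add_comm, ← piPow_smul_piPow_smul hϖ.ne_zero]
    exact piPow_exponent_smul_mem hϖ hd l (piPow_exponent_smul_mem hϖ hd j hy)
  refine ⟨fun i => le_antisymm ?_ ?_, htriangle, fun {i j} hij => ?_⟩
  · exact (exponent_le_iff hϖ hd).2 fun y hy => by rwa [piPow_zero, one_smul]
  · exact nonneg_of_le_add_left (htriangle i i i)
  by_contra! hle
  refine hij (Γ.eq_of_homothetic i j ⟨piPow K ϖ (exponent ϖ Γ i j), piPow_ne_zero hϖ.ne_zero _,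
    le_antisymm (fun y hy => ?_) (smul_le_iff.2 fun y hy => piPow_exponent_smul_mem hϖ hd j hy)⟩)
  rw [mem_piPow_smul_iff hϖ.ne_zero]
  exact (exponent_le_iff hϖ hd).1 (by omega) y hy

omit [IsDomain R] [IsDiscreteValuationRing R] [IsFractionRing R K] in
theorem units_smul_eq (c : Rˣ) (L : Submodule R (Fin d → K)) : algebraMap R K c • L = L := by
  refine le_antisymm (smul_le_iff.2 fun y hy => ?_) fun y hy => ?_
  · rw [algebraMap_smul]
    exact L.smul_mem _ hy
  · have := Submodule.smul_mem_pointwise_smul _ (algebraMap R K c) L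
      (L.smul_mem ((c⁻¹ : Rˣ) : R) hy)
    rwa [algebraMap_smul, smul_smul, Units.mul_inv, one_smul] at this

theorem exists_piPow_smul_eq (hϖ : Irreducible ϖ) {a : K} (ha : a ≠ 0)
    (L : Submodule R (Fin d → K)) : ∃ s : ℤ, a • L = piPow K ϖ s • L := by
  obtain ⟨s, c, hc⟩ := IsDiscreteValuationRing.exists_units_eq_smul_zpow_of_irreducible hϖ ha
  refine ⟨s, ?_⟩
  rw [hc, Units.smul_def, Algebra.smul_def, mul_comm, mul_smul, units_smul_eq, piPow]

theorem Configuration.IsConvex.hasInf (hΓ : Γ.IsConvex) (hϖ : Irreducible ϖ) (hd : 0 < d) :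
    HasInf (exponent ϖ Γ) := by
  intro v w m
  obtain ⟨i, a, ha, hinf⟩ := hΓ v w 1 (piPow K ϖ m) one_ne_zero (piPow_ne_zero hϖ.ne_zero m)
  obtain ⟨s, hs⟩ := exists_piPow_smul_eq hϖ ha (Γ.L i)
  have hmem (y : Fin d → K) :
      piPow K ϖ (-s) • y ∈ Γ.L i ↔ y ∈ Γ.L v ∧ piPow K ϖ (-m) • y ∈ Γ.L w := by
    rw [← mem_piPow_smul_iff hϖ.ne_zero, ← hs, ← hinf, Submodule.mem_inf, one_smul,
      mem_piPow_smul_iff hϖ.ne_zero]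
  have hmem_i {y : Fin d → K} (hy : y ∈ Γ.L i) :
      piPow K ϖ s • y ∈ Γ.L v ∧ piPow K ϖ (-m) • piPow K ϖ s • y ∈ Γ.L w := by
    rwa [← hmem, piPow_smul_piPow_smul hϖ.ne_zero, neg_add_cancel, piPow_zero, one_smul]
  refine ⟨i, s, (exponent_le_iff hϖ hd).2 fun y hy => (hmem_i hy).1,
    (exponent_le_iff hϖ hd).2 fun y hy => ?_, fun u t hv hw => ?_⟩
  · rw [sub_eq_neg_add, ← piPow_smul_piPow_smul hϖ.ne_zero]
    exact (hmem_i hy).2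
  · rw [exponent_le_iff hϖ hd] at hv hw ⊢
    intro y hy
    rw [sub_eq_neg_add, ← piPow_smul_piPow_smul hϖ.ne_zero, hmem,
      piPow_smul_piPow_smul hϖ.ne_zero, ← sub_eq_neg_add]
    exact ⟨hv y hy, hw y hy⟩

end Exponents

section Reductions

variable {R : Type u} [CommRing R] [IsDomain R] [IsDiscreteValuationRing R]
  {K : Type w} [Field K] [Algebra R K] [IsFractionRing R K] {ϖ : R} {d : ℕ} {ι : Type x}
  {Γ : Configuration R K d ι}

theorem one_tmul_eq_zero_iff {A : Type*} [CommRing A] [IsLocalRing A] {p : A}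
    (hp : IsLocalRing.maximalIdeal A = Ideal.span {p}) {N : Type*} [AddCommGroup N] [Module A N]
    (y : N) : (1 : Kappa A) ⊗ₜ[A] y = 0 ↔ ∃ z, p • z = y := by
  have hmk : (1 : Kappa A) ⊗ₜ[A] y = 0 ↔
      y ∈ LinearMap.ker (TensorProduct.mk A (A ⧸ IsLocalRing.maximalIdeal A) N 1) := Iff.rfl
  rw [hmk, LinearMap.ker_tensorProductMk, hp, Submodule.ideal_span_singleton_smul,
    Submodule.mem_smul_pointwise_iff_exists]
  simp only [Submodule.mem_top, true_and]

theorem exists_one_tmul_eq {A : Type*} [CommRing A] [IsLocalRing A] {N : Type*} [AddCommGroup N]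
    [Module A N] (y : Kappa A ⊗[A] N) : ∃ z : N, (1 : Kappa A) ⊗ₜ[A] z = y :=
  TensorProduct.mk_surjective A N (Kappa A) IsLocalRing.residue_surjective y

theorem smallF_one_tmul (hϖ : Irreducible ϖ) (hd : 0 < d) (i j : ι) (y : Γ.L i) :
    smallF ϖ Γ i j (1 ⊗ₜ y) = 1 ⊗ₜ ⟨piPow K ϖ (exponent ϖ Γ i j) • (y : Fin d → K),
      piPow_exponent_smul_mem hϖ hd j y.2⟩ := by
  have hle : piPow K ϖ (exponent ϖ Γ i j) • Γ.L i ≤ Γ.L j := (exponent_isLeast hϖ hd Γ i j).1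
  rw [smallF, LinearMap.baseChange_tmul, bigF, dif_pos hle]
  rfl

theorem smallF_one_tmul_eq_zero_iff (hϖ : Irreducible ϖ) (hd : 0 < d) (i j : ι) (y : Γ.L i) :
    smallF ϖ Γ i j (1 ⊗ₜ y) = 0 ↔
      piPow K ϖ (exponent ϖ Γ i j - 1) • (y : Fin d → K) ∈ Γ.L j := by
  have hy : ϖ • piPow K ϖ (exponent ϖ Γ i j - 1) • (y : Fin d → K) =
      piPow K ϖ (exponent ϖ Γ i j) • (y : Fin d → K) := by
    rw [smul_piPow_smul hϖ.ne_zero, sub_add_cancel]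
  rw [smallF_one_tmul hϖ hd, one_tmul_eq_zero_iff hϖ.maximalIdeal_eq]
  constructor
  · rintro ⟨z, hz⟩
    have hz' : ϖ • (z : Fin d → K) = ϖ • piPow K ϖ (exponent ϖ Γ i j - 1) • (y : Fin d → K) :=
      hy ▸ congrArg Subtype.val hz
    exact smul_right_injective _ hϖ.ne_zero hz' ▸ z.2
  · exact fun hmem => ⟨⟨_, hmem⟩, Subtype.ext hy⟩

theorem smallF_ne_zero (hϖ : Irreducible ϖ) (hd : 0 < d) (i j : ι) : smallF ϖ Γ i j ≠ 0 := by
  intro h0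
  have := (exponent_le_iff hϖ hd (i := i) (j := j) (n := exponent ϖ Γ i j - 1)).2 fun y hy => by
    rw [← smallF_one_tmul_eq_zero_iff hϖ hd i j ⟨y, hy⟩, h0, LinearMap.zero_apply]
  omega

theorem isTransition_smallF (hϖ : Irreducible ϖ) (hd : 0 < d) (Γ : Configuration R K d ι) :
    IsTransition (smallF ϖ Γ) (exponent ϖ Γ) := by
  have hn := isExponentSystem_exponent hϖ hd Γ
  refine ⟨fun i y => ?_, fun i j l y => ?_⟩
  · obtain ⟨z, rfl⟩ := exists_one_tmul_eq y
    rw [smallF_one_tmul hϖ hd]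
    congr 1
    ext1
    dsimp only
    rw [hn.self, piPow_zero, one_smul]
  · obtain ⟨z, rfl⟩ := exists_one_tmul_eq y
    rw [smallF_one_tmul hϖ hd i j]
    split_ifs with hij
    · rw [smallF_one_tmul hϖ hd, smallF_one_tmul hϖ hd]
      congr 1
      ext1
      dsimp only
      rw [piPow_smul_piPow_smul hϖ.ne_zero, add_comm, hij]
    · rw [smallF_one_tmul_eq_zero_iff hϖ hd, piPow_smul_piPow_smul hϖ.ne_zero]
      have hlt : exponent ϖ Γ i l ≤ exponent ϖ Γ j l - 1 + exponent ϖ Γ i j := by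
        have := hn.triangle i j l
        omega
      exact (exponent_le_iff hϖ hd).1 hlt z z.2

theorem exists_smallF_eq (hϖ : Irreducible ϖ) (hd : 0 < d) {i j : ι}
    (hij : exponent ϖ Γ i j + exponent ϖ Γ j i = 1) (y : Γ.Lbar i) (hy : smallF ϖ Γ i j y = 0) :
    ∃ z, smallF ϖ Γ j i z = y := by
  obtain ⟨y, rfl⟩ := exists_one_tmul_eq y
  rw [smallF_one_tmul_eq_zero_iff hϖ hd] at hy
  refine ⟨1 ⊗ₜ ⟨_, hy⟩, ?_⟩
  rw [smallF_one_tmul hϖ hd]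
  congr 1
  ext1
  dsimp only
  have hsum : exponent ϖ Γ j i + (exponent ϖ Γ i j - 1) = 0 := by omega
  rw [piPow_smul_piPow_smul hϖ.ne_zero, hsum, piPow_zero, one_smul]

omit [IsFractionRing R K] in
instance finite_Lbar (i : ι) : Module.Finite (Kappa R) (Γ.Lbar i) := by
  have : Module.Finite R (Γ.L i) := Module.Finite.iff_fg.2 (Γ.isLattice i).fg
  infer_instance

theorem ne_of_range_smallF_eq_ker (hϖ : Irreducible ϖ) (hd : 0 < d) {v w : ι}
    (h : LinearMap.range (smallF ϖ Γ w v) = LinearMap.ker (smallF ϖ Γ v w)) : w ≠ v := by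
  rintro rfl
  have hid : smallF ϖ Γ w w = LinearMap.id :=
    LinearMap.ext ((isTransition_smallF hϖ hd Γ).map_self w)
  rw [hid, LinearMap.range_id, LinearMap.ker_id] at h
  refine smallF_ne_zero (Γ := Γ) hϖ hd w w (LinearMap.ext fun y => ?_)
  have hy : y ∈ (⊥ : Submodule (Kappa R) (Γ.Lbar w)) := h ▸ Submodule.mem_top
  rw [hid, LinearMap.id_apply, (Submodule.mem_bot _).1 hy, LinearMap.zero_apply]

theorem IsLocallyWeaklyIndependent.exists_isLinked (hΓ : IsLocallyWeaklyIndependent ϖ Γ)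
    (hϖ : Irreducible ϖ) (hd : 0 < d) :
    ∃ I : ι → Set ι, IsLinked (smallF ϖ Γ) (exponent ϖ Γ) I := by
  have hn := isExponentSystem_exponent hϖ hd Γ
  have hf := isTransition_smallF hϖ hd Γ
  have hne := smallF_ne_zero (Γ := Γ) hϖ hd
  choose I hcomp hker hindep using hΓ.indep
  have hpred {u v : ι} (huv : u ≠ v) : ∃ w ∈ I v, Between (exponent ϖ Γ) u w v := by
    obtain ⟨w, hw, h⟩ := hcomp v u huv
    exact ⟨w, hw, hf.between_of_eq_comp (hne u v) h⟩
  have huniq {u v w w' : ι} (hw : w ∈ I v) (hw' : w' ∈ I v)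
      (h : Between (exponent ϖ Γ) u w v) (h' : Between (exponent ϖ Γ) u w' v) : w = w' :=
    hf.eq_of_between_of_iSupIndep (hne u v) (hindep v) hw hw' h h'
  exact ⟨I, {
    toIsExponentSystem := hn
    toIsTransition := hf
    exists_pred := hpred
    pred_unique := huniq
    adjacent := fun {v w} hw => hn.add_eq_one_of_hasInf (hΓ.convex.hasInf hϖ hd) hpred huniq hw
      (ne_of_range_smallF_eq_ker hϖ hd (hker v w hw))
    exact := exists_smallF_eq hϖ hd
    indep := hindep
    ne_zero := hne }⟩

end Reductions

/-! ### Representations given by transition maps -/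

section Paths

variable {Q : Type*} [Quiver Q] {n : Q → Q → ℤ} {i j l : Q}

/-- Shortest paths: those along which the exponents are additive. -/
abbrev IsShortest (p : Quiver.Path i j) (n : Q → Q → ℤ) : Prop := p.addWeightOfEPs n = n i j

theorem isShortest_toPath (e : i ⟶ j) : IsShortest e.toPath n := by
  rw [IsShortest, Quiver.Hom.toPath, Quiver.Path.addWeightOfEPs_cons,
    Quiver.Path.addWeightOfEPs_nil, zero_add]

namespace IsExponentSystem

variable (hn : IsExponentSystem n)
include hn

theorem le_addWeightOfEPs (p : Quiver.Path i j) : n i j ≤ p.addWeightOfEPs n := by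
  induction p with
  | nil => rw [Quiver.Path.addWeightOfEPs_nil, hn.self]
  | @cons b c p e ih =>
    rw [Quiver.Path.addWeightOfEPs_cons]
    linarith [hn.triangle i b c]

theorem isShortest_nil : IsShortest (.nil : Quiver.Path i i) n := by
  rw [IsShortest, Quiver.Path.addWeightOfEPs_nil, hn.self]

theorem isShortest_comp (p : Quiver.Path i j) (q : Quiver.Path j l) :
    IsShortest (p.comp q) n ↔ IsShortest p n ∧ IsShortest q n ∧ Between n i j l := by
  have := hn.le_addWeightOfEPs p
  have := hn.le_addWeightOfEPs q
  have := hn.triangle i j l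
  simp only [IsShortest, Quiver.Path.addWeightOfEPs_comp]
  omega

theorem isShortest_cons (p : Quiver.Path i j) (e : j ⟶ l) :
    IsShortest (p.cons e) n ↔ IsShortest p n ∧ Between n i j l := by
  refine (hn.isShortest_comp p e.toPath).trans ?_
  rw [and_iff_right (isShortest_toPath e)]

theorem exists_between_of_two_le_length (hQ : ∀ {i j : Q}, (i ⟶ j) → i ≠ j)
    {p : Quiver.Path i j} (hlen : 2 ≤ p.length) (hp : IsShortest p n) :
    ∃ b, b ≠ i ∧ b ≠ j ∧ Between n i b j := by
  rcases p with _ | ⟨_ | ⟨p, e'⟩, e⟩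
  · simp at hlen
  · simp at hlen
  · rw [hn.isShortest_cons, hn.isShortest_cons] at hp
    refine ⟨_, ?_, hQ e, hp.2⟩
    rintro rfl
    exact hQ e' (hn.eq_of_between hp.1.2).symm

end IsExponentSystem

variable {k : Type*} [Ring k]

/-- A representation of the quiver `Q` on which the shortest paths act by the maps `T`, and all
other paths act by zero. -/
def ActsThrough (N : Paths Q ⥤ ModuleCat k) (T : ∀ i j : Q, N.obj i →ₗ[k] N.obj j)
    (n : Q → Q → ℤ) : Prop :=
  ∀ (i j : Q) (p : Quiver.Path i j) (y : N.obj i),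
    (N.map p).hom y = if IsShortest p n then T i j y else 0

namespace ActsThrough

variable {N N' : Paths Q ⥤ ModuleCat k} {T : ∀ i j : Q, N.obj i →ₗ[k] N.obj j}
  {T' : ∀ i j : Q, N'.obj i →ₗ[k] N'.obj j}

theorem toPath_apply (hT : ActsThrough N T n) (e : i ⟶ j) (y : N.obj i) :
    (N.map e.toPath).hom y = T i j y :=
  (hT i j e.toPath y).trans (if_pos (isShortest_toPath e))

theorem isTransition (hT : ActsThrough N T n) (hn : IsExponentSystem n)
    (hQ : ∀ i j : Q, ∃ p : Quiver.Path i j, IsShortest p n) :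
    IsTransition (ι := Paths Q) (V := fun i => N.obj i) T n where
  map_self i y := by
    refine (if_pos hn.isShortest_nil).symm.trans ((hT i i .nil y).symm.trans ?_)
    exact congrArg (fun φ => φ.hom y) (N.map_id i)
  map_map i j l y := by
    obtain ⟨p, hp⟩ := hQ i j
    obtain ⟨q, hq⟩ := hQ j l
    have hpq : (N.map (p.comp q)).hom y = (N.map q).hom ((N.map p).hom y) :=
      congrArg (fun φ => φ.hom y) (N.map_comp p q)
    have hiff : IsShortest (p.comp q) n ↔ Between n i j l :=
      (hn.isShortest_comp p q).trans ⟨fun h => h.2.2, fun h => ⟨hp, hq, h⟩⟩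
    rw [hT i l, hT j l, hT i j, if_pos hp, if_pos hq, if_congr hiff rfl rfl] at hpq
    exact hpq.symm

theorem naturality_apply (hT : ActsThrough N T n) (hT' : ActsThrough N' T' n)
    (hQ : ∀ i j : Q, ∃ p : Quiver.Path i j, IsShortest p n) (φ : N ⟶ N') (i j : Q) (y : N.obj i) :
    (φ.app j).hom (T i j y) = T' i j ((φ.app i).hom y) := by
  obtain ⟨p, hp⟩ := hQ i j
  have h : (φ.app j).hom ((N.map p).hom y) = (N'.map p).hom ((φ.app i).hom y) :=
    congrArg (fun φ => φ.hom y) (φ.naturality p)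
  rwa [hT i j, hT' i j, if_pos hp, if_pos hp] at h

/-- The morphism of representations given by linear maps that commute with the transition maps. -/
def hom (hT : ActsThrough N T n) (hT' : ActsThrough N' T' n) (a : ∀ i : Q, N.obj i →ₗ[k] N'.obj i)
    (ha : ∀ i j y, a j (T i j y) = T' i j (a i y)) : N ⟶ N' :=
  Paths.liftNatTrans (fun i => ModuleCat.ofHom (a i)) fun {i j} e => by
    refine ModuleCat.hom_ext (LinearMap.ext fun y => ?_)
    change a j ((N.map e.toPath).hom y) = (N'.map e.toPath).hom (a i y)
    rw [hT.toPath_apply, hT'.toPath_apply, ha]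

theorem hom_app_apply (hT : ActsThrough N T n) (hT' : ActsThrough N' T' n)
    (a : ∀ i : Q, N.obj i →ₗ[k] N'.obj i) (ha : ∀ i j y, a j (T i j y) = T' i j (a i y)) (i : Q)
    (y : N.obj i) : ((hT.hom hT' a ha).app i).hom y = a i y :=
  rfl

end ActsThrough

variable {X : Q → Type*} [∀ i, AddCommGroup (X i)] [∀ i, Module k (X i)]

/-- The representation of the quiver `Q` in which the arrows act by the maps `g`. -/
def repOfMaps (g : ∀ i j, X i →ₗ[k] X j) : Paths Q ⥤ ModuleCat k :=
  Paths.lift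
    { obj := fun i => ModuleCat.of k (X i)
      map := fun {i j} _ => ModuleCat.ofHom (g i j) }

theorem IsTransition.actsThrough_repOfMaps {g : ∀ i j, X i →ₗ[k] X j} (hg : IsTransition g n)
    (hn : IsExponentSystem n) : ActsThrough (repOfMaps g) g n := by
  intro i j p y
  induction p with
  | nil =>
    rw [if_pos hn.isShortest_nil]
    exact (hg.map_self i y).symm
  | @cons b c p e ih =>
    refine (congrArg (g b c) ih).trans ?_
    rw [if_congr (hn.isShortest_cons p e) rfl rfl, ite_and]
    split_ifs with hp h
    · exact (hg.map_map i b c y).trans (if_pos h)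
    · exact (hg.map_map i b c y).trans (if_neg h)
    · exact map_zero _

end Paths

section Relations

variable {R : Type u} [CommRing R] [IsDomain R] [IsDiscreteValuationRing R]
  {K : Type w} [Field K] [Algebra R K] {ϖ : R} {d : ℕ} {ι : Type x}
  {Γ : Configuration R K d ι} {I : ι → Set ι}

theorem pathMap_eq_map {i j : FullVertex Γ} (p : Quiver.Path i j) :
    pathMap ϖ Γ i j p = ((repOfMaps (Q := FullVertex Γ) (smallF ϖ Γ)).map p).hom := by
  induction p with
  | nil => rfl
  | cons _ _ ih => exact congrArg (smallF ϖ Γ _ _ ∘ₗ ·) ih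

theorem ActsThrough.sum_smul_map_apply {N : QuiverRep ϖ Γ}
    {T : ∀ i j : Vertex ϖ Γ, N.obj i →ₗ[Kappa R] N.obj j}
    (hT : ActsThrough N T (exponent ϖ Γ)) {i j : Paths (Vertex ϖ Γ)} (c : (i ⟶ j) →₀ Kappa R)
    (y : N.obj i) : (c.sum fun p a => a • N.map p).hom y =
      (∑ p ∈ c.support with IsShortest (Q := Vertex ϖ Γ) p (exponent ϖ Γ), c p) • T i j y := by
  simp only [Finsupp.sum, ModuleCat.hom_sum, LinearMap.sum_apply, ModuleCat.hom_smul,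
    LinearMap.smul_apply, Finset.sum_smul, Finset.sum_filter]
  refine Finset.sum_congr rfl fun p _ => ?_
  rw [hT i j p y]
  split_ifs <;> simp

namespace satisfiesRelations

variable {N : QuiverRep ϖ Γ} (hN : satisfiesRelations ϖ Γ N)
include hN

theorem map_eq_zero {i j : Paths (Vertex ϖ Γ)} {p : i ⟶ j} (hp : (ambientRep ϖ Γ).map p = 0) :
    N.map p = 0 := by
  simpa using hN i j (Finsupp.single p 1) (by simp [hp])

theorem map_eq_map {i j : Paths (Vertex ϖ Γ)} {p q : i ⟶ j}
    (hpq : (ambientRep ϖ Γ).map p = (ambientRep ϖ Γ).map q) : N.map p = N.map q := by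
  have hsum (N : QuiverRep ϖ Γ) : ((Finsupp.single p (1 : Kappa R) - Finsupp.single q 1).sum
      fun p a => a • N.map p) = N.map p - N.map q := by
    rw [Finsupp.sum_sub_index (fun _ _ _ => sub_smul _ _ _)]
    simp
  have hzero := hN i j (Finsupp.single p 1 - Finsupp.single q 1) (by rw [hsum, hpq, sub_self])
  rwa [hsum, sub_eq_zero] at hzero

end satisfiesRelations

namespace IsLinked

variable (H : IsLinked (smallF ϖ Γ) (exponent ϖ Γ) I)
include H

theorem isShortest_of_pathMap_eq {i j : FullVertex Γ} {p : Quiver.Path i j}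
    (hp : pathMap ϖ Γ i j p = smallF ϖ Γ i j) : IsShortest p (exponent ϖ Γ) := by
  by_contra hnot
  refine H.ne_zero i j (LinearMap.ext fun y => ?_)
  rw [← hp, pathMap_eq_map]
  exact (H.actsThrough_repOfMaps (Q := FullVertex Γ) H.toIsExponentSystem i j p y).trans
    (if_neg hnot)

theorem nonempty_hom {v w : ι} (hw : w ∈ I v) : Nonempty (Quiver.Hom (V := Vertex ϖ Γ) w v) := by
  refine ⟨⟨H.ne_of_mem hw, ?_⟩⟩
  rintro ⟨p, hlen, hp⟩
  obtain ⟨b, hbw, hbv, hb⟩ := H.exists_between_of_two_le_length (Q := FullVertex Γ)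
    PLift.down hlen (H.isShortest_of_pathMap_eq hp)
  exact (H.eq_or_eq_of_between hw hb).elim hbw hbv

theorem exists_isShortest [Finite ι] (u v : Vertex ϖ Γ) :
    ∃ p : Quiver.Path u v, IsShortest p (exponent ϖ Γ) := by
  refine H.induction_from u (motive := fun v => ∃ p : Quiver.Path (V := Vertex ϖ Γ) u v,
    IsShortest p (exponent ϖ Γ)) (fun v ih => ?_) v
  obtain rfl | huv := eq_or_ne u v
  · exact ⟨.nil, H.isShortest_nil (Q := Vertex ϖ Γ)⟩
  obtain ⟨w, hw, huw⟩ := H.exists_pred huv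
  obtain ⟨p, hp⟩ := ih w (H.ne_of_mem hw) huw
  obtain ⟨e⟩ := H.nonempty_hom hw
  exact ⟨p.cons e, (H.isShortest_cons (Q := Vertex ϖ Γ) p e).2 ⟨hp, huw⟩⟩

theorem actsThrough_ambientRep :
    ActsThrough (ambientRep ϖ Γ) (smallF ϖ Γ) (exponent ϖ Γ) :=
  H.actsThrough_repOfMaps (Q := Vertex ϖ Γ) H.toIsExponentSystem

theorem satisfiesRelations_of_actsThrough {N : QuiverRep ϖ Γ}
    {T : ∀ i j : Vertex ϖ Γ, N.obj i →ₗ[Kappa R] N.obj j}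
    (hT : ActsThrough N T (exponent ϖ Γ)) : satisfiesRelations ϖ Γ N := by
  intro i j c hc
  obtain ⟨y, hy⟩ := DFunLike.ne_iff.1 (H.ne_zero i j)
  have hzero := (H.actsThrough_ambientRep.sum_smul_map_apply c y).symm.trans
    (congrArg (fun φ => φ.hom y) hc)
  have hsum := (smul_eq_zero.1 hzero).resolve_right hy
  refine ModuleCat.hom_ext (LinearMap.ext fun y => ?_)
  rw [hT.sum_smul_map_apply, hsum, zero_smul]
  rfl

theorem exists_actsThrough [Finite ι] {N : QuiverRep ϖ Γ} (hN : satisfiesRelations ϖ Γ N) :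
    ∃ T : ∀ i j : Vertex ϖ Γ, N.obj i →ₗ[Kappa R] N.obj j, ActsThrough N T (exponent ϖ Γ) := by
  choose p hp using H.exists_isShortest
  refine ⟨fun i j => (N.map (p i j)).hom, fun i j q y => ?_⟩
  split_ifs with hq
  · have hmap : (ambientRep ϖ Γ).map q = (ambientRep ϖ Γ).map (p i j) :=
      ModuleCat.hom_ext <| LinearMap.ext fun z =>
        ((H.actsThrough_ambientRep i j q z).trans (if_pos hq)).trans
          ((H.actsThrough_ambientRep i j (p i j) z).trans (if_pos (hp i j))).symm
    exact congrArg (fun φ : N.obj i ⟶ N.obj j => φ.hom y) (hN.map_eq_map hmap)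
  · have hmap : (ambientRep ϖ Γ).map q = 0 :=
      ModuleCat.hom_ext <| LinearMap.ext fun z =>
        (H.actsThrough_ambientRep i j q z).trans (if_neg hq)
    exact congrArg (fun φ : N.obj i ⟶ N.obj j => φ.hom y) (hN.map_eq_zero hmap)

end IsLinked

end Relations

section AdaptedBasis

variable {k : Type*} [Field k] {ι : Type*} {V : ι → Type*} [∀ u, AddCommGroup (V u)]
  [∀ u, Module k (V u)] {f : ∀ u v, V u →ₗ[k] V v} {n : ι → ι → ℤ}
  {U : ∀ u, Submodule k (V u)}

theorem IsTransition.restrict (hf : IsTransition f n) (hU : IsStable f U) :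
    IsTransition (fun u v => (f u v).restrict (hU u v)) n where
  map_self u y := Subtype.ext (hf.map_self u y)
  map_map u v w y := by
    refine Subtype.ext ((hf.map_map u v w y).trans ?_)
    split_ifs <;> rfl

variable {t : ι → ℕ} {e : ∀ s : (Σ u, Fin (t u)), V s.1}

theorem IsAdapted.of_basis (b : ∀ v, Module.Basis (Σ u, Fin (t u)) k (U v))
    (hb : ∀ v s, (b v s : V v) = f s.1 v (e s)) : IsAdapted f U e := by
  have hcoe (v : ι) : (fun s => f s.1 v (e s)) = (U v).subtype ∘ b v :=
    funext fun s => (hb v s).symm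
  constructor <;> intro v
  · rw [hcoe]
    exact (b v).linearIndependent.map' (U v).subtype (Submodule.ker_subtype _)
  · rw [hcoe, Set.range_comp, ← Submodule.map_span, (b v).span_eq, Submodule.map_top,
      Submodule.range_subtype]

namespace IsAdapted

/-- The basis at the vertex `v` given by the images of the generators. -/
noncomputable def basis (he : IsAdapted f U e) (v : ι) :
    Module.Basis (Σ u, Fin (t u)) k (U v) :=
  (Module.Basis.span (he.indep v)).map (LinearEquiv.ofEq _ _ (he.span v))

theorem coe_basis (he : IsAdapted f U e) (v : ι) (s : Σ u, Fin (t u)) :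
    (he.basis v s : V v) = f s.1 v (e s) := by
  simp [basis, Module.Basis.span_apply]

theorem restrict_basis (he : IsAdapted f U e) (hf : IsTransition f n) (hU : IsStable f U)
    (u v : ι) (s : Σ u, Fin (t u)) : (f u v).restrict (hU u v) (he.basis u s) =
      if Between n s.1 u v then he.basis v s else 0 := by
  refine Subtype.ext ((congrArg (f u v) (he.coe_basis u s)).trans ((hf.map_map _ _ _ _).trans ?_))
  split_ifs
  · exact (he.coe_basis v s).symm
  · rfl

theorem restrict_basis_self (he : IsAdapted f U e) (hf : IsTransition f n)
    (hn : IsExponentSystem n) (hU : IsStable f U) (v : ι) (s : Σ u, Fin (t u)) :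
    (f s.1 v).restrict (hU s.1 v) (he.basis s.1 s) = he.basis v s :=
  (he.restrict_basis hf hU s.1 v s).trans (if_pos (hn.between_left s.1 v))

variable {W : ι → Type*} [∀ u, AddCommGroup (W u)] [∀ u, Module k (W u)]
  {T : ∀ u v, W u →ₗ[k] W v}

/-- The linear maps on the family `U` which send the generators `e s` to the elements `y s` of
another system. -/
noncomputable def lift (he : IsAdapted f U e) (T : ∀ u v, W u →ₗ[k] W v)
    (y : ∀ s : (Σ u, Fin (t u)), W s.1) (v : ι) : U v →ₗ[k] W v :=
  (he.basis v).constr k fun s => T s.1 v (y s)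

theorem lift_basis (he : IsAdapted f U e) (y : ∀ s : (Σ u, Fin (t u)), W s.1) (v : ι)
    (s : Σ u, Fin (t u)) : he.lift T y v (he.basis v s) = T s.1 v (y s) :=
  (he.basis v).constr_basis k _ s

theorem lift_restrict (he : IsAdapted f U e) (hf : IsTransition f n) (hU : IsStable f U)
    (hT : IsTransition T n) (y : ∀ s : (Σ u, Fin (t u)), W s.1) (u v : ι) (z : U u) :
    he.lift T y v ((f u v).restrict (hU u v) z) = T u v (he.lift T y u z) := by
  suffices he.lift T y v ∘ₗ (f u v).restrict (hU u v) = T u v ∘ₗ he.lift T y u from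
    LinearMap.congr_fun this z
  refine (he.basis u).ext fun s => ?_
  rw [LinearMap.comp_apply, LinearMap.comp_apply, he.restrict_basis hf hU, lift_basis, hT.map_map]
  split_ifs
  · exact he.lift_basis y v s
  · exact map_zero _

end IsAdapted

end AdaptedBasis

section Points

variable {R : Type u} [CommRing R] [IsDomain R] [IsDiscreteValuationRing R]
  {K : Type w} [Field K] [Algebra R K] {ϖ : R} {d : ℕ} {ι : Type x}
  {Γ : Configuration R K d ι} {I : ι → Set ι} {r : ℕ}

namespace BoundRep

variable {N N' : BoundRep ϖ Γ}

theorem epi_hom (g : N ⟶ N') [Epi g] : Epi g.hom := by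
  have hC : satisfiesRelations ϖ Γ (Limits.cokernel g.hom) := by
    intro i j c hc
    have hN' := N'.property i j c hc
    have : Epi ((Limits.cokernel.π g.hom).app i) := inferInstance
    rw [← cancel_epi ((Limits.cokernel.π g.hom).app i), Limits.comp_zero, Finsupp.sum,
      Preadditive.comp_sum]
    simp only [Linear.comp_smul, ← NatTrans.naturality]
    simp only [← Linear.smul_comp]
    rw [← Preadditive.sum_comp]
    rw [Finsupp.sum] at hN'
    rw [hN', Limits.zero_comp]
  let C : BoundRep ϖ Γ := ⟨Limits.cokernel g.hom, hC⟩
  let π : N' ⟶ C := ObjectProperty.homMk (Limits.cokernel.π g.hom)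
  have hπ : π = ObjectProperty.homMk 0 := by
    rw [← cancel_epi g]
    ext1
    exact (Limits.cokernel.condition g.hom).trans Limits.comp_zero.symm
  exact Abelian.epi_of_cokernel_π_eq_zero _ (congrArg (fun h => h.hom) hπ)

theorem surjective_app (g : N ⟶ N') [Epi g] (i : Paths (Vertex ϖ Γ)) :
    Function.Surjective (g.hom.app i).hom := by
  have := epi_hom g
  exact (ModuleCat.epi_iff_surjective _).1 inferInstance

end BoundRep

theorem SpecialFiber.isStable (M : SpecialFiber ϖ Γ r) : IsStable (smallF ϖ Γ) M.E :=
  M.smallF_mem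

namespace IsLinked

variable (H : IsLinked (smallF ϖ Γ) (exponent ϖ Γ) I)
include H

theorem actsThrough_rep (M : SpecialFiber ϖ Γ r) : ActsThrough M.rep
    (fun i j => (smallF ϖ Γ i j).restrict (M.isStable i j)) (exponent ϖ Γ) := by
  intro i j p y
  refine Subtype.ext ((congrArg (fun φ => φ.hom y) (M.incl.naturality p)).trans ?_)
  refine (H.actsThrough_ambientRep i j p ((M.incl.app i).hom y)).trans ?_
  split_ifs <;> rfl

end IsLinked

namespace IsAdapted

variable [Finite ι] {t : ι → ℕ} {e e' : ∀ s : (Σ u, Fin (t u)), Γ.Lbar s.1}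
  {M M' : SpecialFiber ϖ Γ r} (he : IsAdapted (smallF ϖ Γ) M.E e)
  (H : IsLinked (smallF ϖ Γ) (exponent ϖ Γ) I)
include he H

theorem hom_app_basis {N : QuiverRep ϖ Γ} {T : ∀ i j : Vertex ϖ Γ, N.obj i →ₗ[Kappa R] N.obj j}
    (hT : ActsThrough N T (exponent ϖ Γ)) (φ : M.rep ⟶ N) (v : ι) (s : Σ u, Fin (t u)) :
    (φ.app v).hom (he.basis v s) = T s.1 v ((φ.app s.1).hom (he.basis s.1 s)) :=
  (congrArg (φ.app v).hom
    (he.restrict_basis_self H.toIsTransition H.toIsExponentSystem M.isStable v s)).symm.trans <|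
    (H.actsThrough_rep M).naturality_apply hT H.exists_isShortest φ s.1 v (he.basis s.1 s)

theorem hom_ext {N : QuiverRep ϖ Γ} (hN : satisfiesRelations ϖ Γ N) {φ ψ : M.rep ⟶ N}
    (h : ∀ s : Σ u, Fin (t u),
      (φ.app s.1).hom (he.basis s.1 s) = (ψ.app s.1).hom (he.basis s.1 s)) : φ = ψ := by
  obtain ⟨T, hT⟩ := H.exists_actsThrough hN
  refine NatTrans.ext (funext fun v => ModuleCat.hom_ext ((he.basis v).ext fun s => ?_))
  exact (he.hom_app_basis H hT φ v s).trans <|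
    (congrArg (T s.1 v) (h s)).trans (he.hom_app_basis H hT ψ v s).symm

theorem exists_hom {N : QuiverRep ϖ Γ} (hN : satisfiesRelations ϖ Γ N)
    (y : ∀ s : (Σ u, Fin (t u)), N.obj (s.1 : Vertex ϖ Γ)) :
    ∃ φ : M.rep ⟶ N, ∀ s : (Σ u, Fin (t u)), (φ.app s.1).hom (he.basis s.1 s) = y s := by
  obtain ⟨T, hT⟩ := H.exists_actsThrough hN
  let W (u : ι) : ModuleCat (Kappa R) := N.obj u
  have hTtrans : IsTransition (V := fun u => W u) T (exponent ϖ Γ) :=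
    hT.isTransition H.toIsExponentSystem H.exists_isShortest
  have hcomm := he.lift_restrict H.toIsTransition M.isStable hTtrans y
  refine ⟨(H.actsThrough_rep M).hom hT (he.lift (W := fun u => W u) T y) hcomm, fun s => ?_⟩
  have hlift := (he.lift_basis (W := fun u => W u) y s.1 s).trans (hTtrans.map_self s.1 (y s))
  exact ((H.actsThrough_rep M).hom_app_apply hT _ hcomm s.1 (he.basis s.1 s)).trans hlift

theorem isProjective : M.IsProjective := by
  refine ⟨fun {X Y} φ g _ => ?_⟩
  have hsurj (s : Σ u, Fin (t u)) :=
    BoundRep.surjective_app g s.1 ((φ.hom.app s.1).hom (he.basis s.1 s))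
  choose y hy using hsurj
  obtain ⟨l, hl⟩ := he.exists_hom H X.property y
  refine ⟨ObjectProperty.homMk l, ObjectProperty.hom_ext _ (he.hom_ext H Y.property fun s => ?_)⟩
  exact (congrArg (g.hom.app s.1).hom (hl s)).trans (hy s)

theorem nonempty_iso (he' : IsAdapted (smallF ϖ Γ) M'.E e') : Nonempty (M.rep ≅ M'.rep) := by
  obtain ⟨φ, hφ⟩ := he.exists_hom H M'.satisfiesRelations_rep fun s => he'.basis s.1 s
  obtain ⟨ψ, hψ⟩ := he'.exists_hom H M.satisfiesRelations_rep fun s => he.basis s.1 s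
  refine ⟨⟨φ, ψ, he.hom_ext H M.satisfiesRelations_rep fun s => ?_,
    he'.hom_ext H M'.satisfiesRelations_rep fun s => ?_⟩⟩
  · exact (congrArg (ψ.app s.1).hom (hφ s)).trans (hψ s)
  · exact (congrArg (φ.app s.1).hom (hψ s)).trans (hφ s)

theorem of_iso (α : M.rep ≅ M'.rep) :
    ∃ e' : ∀ s : (Σ u, Fin (t u)), Γ.Lbar s.1, IsAdapted (smallF ϖ Γ) M'.E e' := by
  let b (v : ι) : Module.Basis (Σ u, Fin (t u)) (Kappa R) (M'.E v) :=
    (he.basis v).map (α.app (v : Vertex ϖ Γ)).toLinearEquiv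
  refine ⟨fun s => b s.1 s, IsAdapted.of_basis b fun v s => ?_⟩
  exact congrArg Subtype.val (he.hom_app_basis H (H.actsThrough_rep M') α.hom v s)

end IsAdapted

end Points

/-! ### Projective points are exact -/

section CoverMap

variable {k : Type*} [Field k] {ι : Type*} {V : ι → Type*} [∀ u, AddCommGroup (V u)]
  [∀ u, Module k (V u)] {f : ∀ u v, V u →ₗ[k] V v} {n : ι → ι → ℤ} {I : ι → Set ι}
  {U : ∀ u, Submodule k (V u)} {σ : Type*} [Fintype σ] {src : σ → ι}

/-- The map to the family `U` from the free system which has, for each `s`, a copy of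
`U (src s)` as its space of generators at `src s`. -/
def coverMap (hU : IsStable f U) (src : σ → ι) (v : ι) : (∀ s, U (src s)) →ₗ[k] U v :=
  ∑ s, (f (src s) v).restrict (hU (src s) v) ∘ₗ LinearMap.proj s

theorem coe_coverMap (hU : IsStable f U) (v : ι) (y : ∀ s, U (src s)) :
    (coverMap hU src v y : V v) = ∑ s, f (src s) v (y s) := by
  simp [coverMap]

theorem map_coverMap (hf : IsTransition f n) (hU : IsStable f U) (u v : ι)
    (y : ∀ s, U (src s)) : f u v (coverMap hU src u y) =
      ∑ s, if Between n (src s) u v then f (src s) v (y s) else 0 := by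
  simp only [coe_coverMap, map_sum, hf.map_map]

theorem coverMap_cut (hf : IsTransition f n) (hU : IsStable f U) (u v : ι)
    (y : ∀ s, U (src s)) : coverMap hU src v (cut k n src u v y) =
      (f u v).restrict (hU u v) (coverMap hU src u y) := by
  refine Subtype.ext ((coe_coverMap hU v _).trans ((map_coverMap hf hU u v y).trans ?_).symm)
  refine Finset.sum_congr rfl fun s _ => ?_
  rw [cut_apply]
  split_ifs <;> simp

theorem coverMap_surjective (hf : IsTransition f n) (hU : IsStable f U)
    (hsrc : Function.Surjective src) (v : ι) : Function.Surjective (coverMap hU src v) := by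
  classical
  intro y
  obtain ⟨s, rfl⟩ := hsrc v
  refine ⟨Pi.single s y, Subtype.ext ?_⟩
  rw [coe_coverMap, Finset.sum_eq_single s]
  · rw [Pi.single_eq_same, hf.map_self]
  · intro s' _ hs'
    rw [Pi.single_eq_of_ne hs']
    exact map_zero _
  · simp

theorem IsLinked.isExact_of_section (H : IsLinked f n I) (hU : IsStable f U)
    (φ : ∀ u, U u →ₗ[k] ∀ s, U (src s))
    (hφ : ∀ u v y, φ v ((f u v).restrict (hU u v) y) = cut k n src u v (φ u y))
    (hsec : ∀ u y, coverMap hU src u (φ u y) = y) : IsExact f I U := by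
  intro v w hw y hy hy0
  let Y := φ w ⟨y, hy⟩
  have hcut : cut k n src w v Y = 0 := by
    rw [← hφ, show (f w v).restrict (hU w v) ⟨y, hy⟩ = 0 from Subtype.ext hy0, map_zero]
  have hzero (s : σ) (hs : Between n (src s) w v) : Y s = 0 :=
    (if_pos hs).symm.trans ((cut_apply src w v Y s).symm.trans (congrFun hcut s))
  refine ⟨coverMap hU src v Y, (coverMap hU src v Y).2, ?_⟩
  calc f v w (coverMap hU src v Y)
      = ∑ s, if Between n (src s) v w then f (src s) w (Y s) else 0 :=
        map_coverMap H.toIsTransition hU v w Y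
    _ = ∑ s, f (src s) w (Y s) := by
        refine Finset.sum_congr rfl fun s _ => ite_eq_left_iff.2 fun hs => ?_
        rw [hzero s ((H.between_or_between_to (H.adjacent hw) (src s)).resolve_right hs),
          ZeroMemClass.coe_zero, map_zero]
    _ = y := (coe_coverMap hU w Y).symm.trans (congrArg Subtype.val (hsec w ⟨y, hy⟩))

end CoverMap

section Covers

variable {R : Type u} [CommRing R] [IsDomain R] [IsDiscreteValuationRing R]
  {K : Type w} [Field K] [Algebra R K] {ϖ : R} {d : ℕ} {ι : Type x}
  {Γ : Configuration R K d ι} {I : ι → Set ι} {r : ℕ}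

theorem BoundRep.epi_of_surjective_app {N N' : BoundRep ϖ Γ} (g : N ⟶ N')
    (hg : ∀ i : Vertex ϖ Γ, Function.Surjective (g.hom.app i).hom) : Epi g := by
  have happ (i : Paths (Vertex ϖ Γ)) : Epi (g.hom.app i) :=
    (ModuleCat.epi_iff_surjective _).2 (hg i)
  have : Epi g.hom := NatTrans.epi_of_epi_app _
  exact (satisfiesRelations ϖ Γ).ι.epi_of_epi_map this

theorem SpecialFiber.IsProjective.isExact [Finite ι] {M : SpecialFiber ϖ Γ r}
    (hM : M.IsProjective) (H : IsLinked (smallF ϖ Γ) (exponent ϖ Γ) I) :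
    IsExact (smallF ϖ Γ) I M.E := by
  -- The index type `ι` is replaced by `Fin N` to keep the cover in the right universe.
  let c := (Finite.equivFin ι).symm
  have hact : ActsThrough (repOfMaps (Q := Vertex ϖ Γ) (X := fun _ => ∀ a, M.E (c a))
      (cut (Kappa R) (exponent ϖ Γ) c)) (cut (Kappa R) (exponent ϖ Γ) c) (exponent ϖ Γ) :=
    (H.isTransition_cut c).actsThrough_repOfMaps H.toIsExponentSystem
  let P : BoundRep ϖ Γ := ⟨_, H.satisfiesRelations_of_actsThrough hact⟩
  let π : P ⟶ M.boundRep := ObjectProperty.homMk <|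
    hact.hom (H.actsThrough_rep M) (coverMap M.isStable c)
      (coverMap_cut H.toIsTransition M.isStable)
  have : Epi π := BoundRep.epi_of_surjective_app π
    (coverMap_surjective H.toIsTransition M.isStable c.surjective)
  have : Projective M.boundRep := hM
  let σ : M.boundRep ⟶ P := Projective.factorThru (𝟙 _) π
  have hσ : σ ≫ π = 𝟙 _ := Projective.factorThru_comp _ _
  exact H.isExact_of_section M.isStable (fun i => (σ.hom.app (i : Vertex ϖ Γ)).hom)
    ((H.actsThrough_rep M).naturality_apply hact H.exists_isShortest σ.hom)
    fun i y => congrArg (fun g => (g.hom.app (i : Vertex ϖ Γ)).hom y) hσ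

end Covers

/-! ### Lines of families of vectors -/

section Lines

variable {k : Type*} [Field k]

theorem finite_setOf_eval_add_smul_eq_zero {σ : Type*} {p : MvPolynomial σ k} {y z : σ → k}
    {t₀ : k} (h : MvPolynomial.eval (y + t₀ • z) p ≠ 0) :
    {t : k | MvPolynomial.eval (y + t • z) p = 0}.Finite := by
  let q : Polynomial k :=
    MvPolynomial.aeval (fun s => Polynomial.C (y s) + Polynomial.X * Polynomial.C (z s)) p
  have hq (t : k) : q.eval t = MvPolynomial.eval (y + t • z) p := by
    simp only [q, ← Polynomial.coe_evalRingHom, MvPolynomial.aeval_def, MvPolynomial.hom_eval₂,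
      MvPolynomial.eval, MvPolynomial.coe_eval₂Hom]
    congr 1
    · ext; simp
    · ext; simp [mul_comm t]
  have hq0 : q ≠ 0 := by
    rintro h0
    rw [← hq, h0, Polynomial.eval_zero] at h
    exact h rfl
  simpa only [Polynomial.IsRoot, hq] using Polynomial.finite_setOfPred_isRoot hq0

variable {V : Type*} [AddCommGroup V] [Module k V] {m : ℕ}

theorem linearIndependent_of_det_ne_zero {g : V →ₗ[k] Fin m → k} {y : Fin m → V}
    (h : (Matrix.of fun a b => g (y a) b).det ≠ 0) : LinearIndependent k y :=
  LinearIndependent.of_comp g (Matrix.linearIndependent_rows_of_det_ne_zero h)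

theorem exists_det_eq_one {y : Fin m → V} (h : LinearIndependent k y) :
    ∃ g : V →ₗ[k] Fin m → k, (Matrix.of fun a b => g (y a) b).det = 1 := by
  obtain ⟨g, hg⟩ := LinearMap.exists_leftInverse_of_injective (Fintype.linearCombination k y)
    (LinearMap.ker_eq_bot.2 h.fintypeLinearCombination_injective)
  have hgy (a : Fin m) : g (y a) = Pi.single a 1 := by
    simpa using LinearMap.congr_fun hg (Pi.single a 1)
  have hone : (Matrix.of fun a b => g (y a) b) = 1 := by
    ext a b
    simp only [Matrix.of_apply, hgy, Matrix.one_eq_pi_single]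
  exact ⟨g, hone ▸ Matrix.det_one⟩

theorem finite_setOf_not_linearIndependent {y z : Fin m → V} {t₀ : k}
    (h : LinearIndependent k (y + t₀ • z)) :
    {t : k | ¬ LinearIndependent k (y + t • z)}.Finite := by
  obtain ⟨g, hg⟩ := exists_det_eq_one h
  have hdet (t : k) : MvPolynomial.eval
      ((fun s : Fin m × Fin m => g (y s.1) s.2) + t • fun s => g (z s.1) s.2)
      (Matrix.mvPolynomialX (Fin m) (Fin m) k).det =
        (Matrix.of fun a b => g ((y + t • z) a) b).det := by
    rw [Matrix.eval_det_mvPolynomialX]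
    congr 1
    ext a b
    simp
  have hne := (hdet t₀).trans_ne (hg.trans_ne one_ne_zero)
  refine (finite_setOf_eval_add_smul_eq_zero hne).subset fun t ht => ?_
  by_contra hne
  exact ht (linearIndependent_of_det_ne_zero ((hdet t).symm.trans_ne hne))

theorem le_finrank_span_range_iff {σ : Type*} [Finite σ] (y : σ → V) :
    m ≤ Module.finrank k (Submodule.span k (Set.range y)) ↔
      ∃ a : Fin m → σ, LinearIndependent k (y ∘ a) := by
  have := Module.Finite.span_of_finite k (Set.finite_range y)
  constructor
  · intro h
    obtain ⟨g, hg, -, hli⟩ := Submodule.exists_fun_fin_finrank_span_eq k (Set.range y)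
    choose a ha using hg
    refine ⟨a ∘ Fin.castLE h, ?_⟩
    rw [← Function.comp_assoc, show y ∘ a = g from funext ha]
    exact hli.comp _ (Fin.castLE_injective h)
  · rintro ⟨a, ha⟩
    rw [← Fintype.card_fin m, ← finrank_span_eq_card ha]
    exact Submodule.finrank_mono (Submodule.span_mono (Set.range_comp_subset_range _ _))

theorem exists_linearIndependent_span_range_eq {U : Submodule k V} [FiniteDimensional k U]
    (hU : Module.finrank k U = m) :
    ∃ y : Fin m → V, LinearIndependent k y ∧ Submodule.span k (Set.range y) = U := by
  let b := Module.finBasisOfFinrankEq k U hU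
  refine ⟨U.subtype ∘ b, b.linearIndependent.map' U.subtype U.ker_subtype, ?_⟩
  rw [Set.range_comp, ← Submodule.map_span, b.span_eq, Submodule.map_top, Submodule.range_subtype]

end Lines

section Topology

variable {R : Type u} [CommRing R] [IsDomain R] [IsDiscreteValuationRing R]
  {K : Type w} [Field K] [Algebra R K] {ϖ : R} {d : ℕ} {ι : Type x}
  {Γ : Configuration R K d ι} {r : ℕ}

theorem baseChange_mulMap_eq_or_eq_zero [IsFractionRing R K] (hϖ : Irreducible ϖ) (hd : 0 < d)
    {i j : ι} {k : ℤ} (h : piPow K ϖ k • Γ.L i ≤ Γ.L j) (y : Γ.Lbar i) :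
    (mulMap (piPow K ϖ k) h).baseChange (Kappa R) y = smallF ϖ Γ i j y ∨
      (mulMap (piPow K ϖ k) h).baseChange (Kappa R) y = 0 := by
  obtain ⟨y, rfl⟩ := exists_one_tmul_eq y
  rw [LinearMap.baseChange_tmul]
  rcases ((exponent_le_iff hϖ hd).2 (smul_le_iff.1 h)).eq_or_lt with rfl | hlt
  · exact .inl (smallF_one_tmul hϖ hd i j y).symm
  · refine .inr ((one_tmul_eq_zero_iff hϖ.maximalIdeal_eq _).2 ⟨⟨piPow K ϖ (k - 1) • y,
      (exponent_le_iff hϖ hd).1 (Int.le_sub_one_of_lt hlt) y y.2⟩, Subtype.ext ?_⟩)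
    exact (smul_piPow_smul hϖ.ne_zero _ _).trans (by rw [sub_add_cancel]; rfl)

namespace SpecialFiber

/-- The point given by a stable family of subspaces. -/
noncomputable def ofIsStable [IsFractionRing R K] (hϖ : Irreducible ϖ) (hd : 0 < d)
    {U : ∀ i, Submodule (Kappa R) (Γ.Lbar i)} (hU : IsStable (smallF ϖ Γ) U)
    (hr : ∀ i, Module.finrank (Kappa R) (U i) = r) : SpecialFiber ϖ Γ r where
  E := U
  finrank_eq := hr
  compat i j k h y hy := by
    rcases baseChange_mulMap_eq_or_eq_zero hϖ hd h y with hy' | hy' <;> rw [hy']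
    · exact hU i j y hy
    · exact Submodule.zero_mem _

/-- The families `y i` of vectors are bases of the subspaces of the point `N`. Unlike for
`Framed`, the vectors are not bundled with the point, so that they can vary along a line. -/
def IsFrame (N : SpecialFiber ϖ Γ r) (y : ∀ i, Fin r → Γ.Lbar i) : Prop :=
  ∀ i, LinearIndependent (Kappa R) (y i) ∧ Submodule.span (Kappa R) (Set.range (y i)) = N.E i

/-- The framed point given by a frame. -/
noncomputable def IsFrame.framed {N : SpecialFiber ϖ Γ r} {y : ∀ i, Fin r → Γ.Lbar i}
    (h : N.IsFrame y) : Framed ϖ Γ r where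
  point := N
  basis i := (Module.Basis.span (h i).1).map (LinearEquiv.ofEq _ _ (h i).2)

theorem IsFrame.coord_framed {N : SpecialFiber ϖ Γ r} {y : ∀ i, Fin r → Γ.Lbar i}
    (h : N.IsFrame y) : h.framed.coord = fun s => s.2.2 (y s.1 s.2.1) :=
  funext fun s => congrArg s.2.2
    (congrArg Subtype.val (Module.Basis.span_apply (h s.1).1 s.2.1))

/-- The coordinates are affine functions of the parameter of a line of frames. -/
theorem IsFrame.finite_setOf_notMem {y z : ∀ i, Fin r → Γ.Lbar i} {t₀ : Kappa R}
    {N₀ : SpecialFiber ϖ Γ r} (h₀ : N₀.IsFrame (y + t₀ • z)) {W : Set (SpecialFiber ϖ Γ r)}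
    (hW : IsOpen W) (hN₀ : N₀ ∈ W) :
    {t : Kappa R | ∃ N : SpecialFiber ϖ Γ r, N.IsFrame (y + t • z) ∧ N ∉ W}.Finite := by
  obtain ⟨S, hS⟩ := (isClosed_iff Wᶜ).1 hW.isClosed_compl
  obtain ⟨p, hp, hp₀⟩ : ∃ p ∈ S, MvPolynomial.eval h₀.framed.coord p ≠ 0 := by
    have := (not_congr (hS h₀.framed)).1 fun h => h hN₀
    push Not at this
    exact this
  have hcoord {t : Kappa R} {N : SpecialFiber ϖ Γ r} (h : N.IsFrame (y + t • z)) :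
      h.framed.coord = (fun s => s.2.2 (y s.1 s.2.1)) + t • fun s => s.2.2 (z s.1 s.2.1) := by
    rw [h.coord_framed]
    ext s
    simp
  rw [hcoord h₀] at hp₀
  refine (finite_setOf_eval_add_smul_eq_zero hp₀).subset ?_
  rintro t ⟨N, hN, hNW⟩
  rw [Set.mem_ofPred_eq, ← hcoord hN]
  exact (hS hN.framed).1 hNW p hp

theorem exists_isFrame (N : SpecialFiber ϖ Γ r) : ∃ y, N.IsFrame y := by
  choose y hy using fun i => exists_linearIndependent_span_range_eq (N.finrank_eq i)
  exact ⟨y, hy⟩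

theorem IsFrame.map {M N : SpecialFiber ϖ Γ r} {y : ∀ i, Fin r → Γ.Lbar i} (h : M.IsFrame y)
    {g : ∀ i, Module.End (Kappa R) (Γ.Lbar i)} (hg : ∀ i, Function.Injective (g i))
    (hN : ∀ i, (M.E i).map (g i) = N.E i) : N.IsFrame fun i => g i ∘ y i := by
  refine fun i => ⟨(h i).1.map' (g i) (LinearMap.ker_eq_bot.2 (hg i)), ?_⟩
  rw [Set.range_comp, ← Submodule.map_span, (h i).2, hN]

theorem rankVector_eq_finrank_span (b : Framed ϖ Γ r) (u v : ι) :
    b.point.rankVector u v = Module.finrank (Kappa R)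
      (Submodule.span (Kappa R) (Set.range fun a => smallF ϖ Γ u v (b.basis u a))) := by
  have hrange : (Set.range fun a => smallF ϖ Γ u v (b.basis u a)) =
      smallF ϖ Γ u v '' ((b.point.E u).subtype '' Set.range (b.basis u)) := by
    rw [← Set.range_comp, ← Set.range_comp]
    rfl
  rw [rankVector, hrange, ← Submodule.map_span, ← Submodule.map_span, (b.basis u).span_eq,
    Submodule.map_top, Submodule.range_subtype]

/-- The equations are the minors of size `m + 1`, in all coordinates of the target. -/
theorem isClosed_setOf_rankVector_le (u v : ι) (m : ℕ) :
    IsClosed {N : SpecialFiber ϖ Γ r | N.rankVector u v ≤ m} := by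
  let minor (s : (Fin (m + 1) → Fin r) × (Γ.Lbar v →ₗ[Kappa R] Fin (m + 1) → Kappa R)) :
      MvPolynomial (Σ i, Fin r × Module.Dual (Kappa R) (Γ.Lbar i)) (Kappa R) :=
    (Matrix.of fun p q =>
      MvPolynomial.X ⟨u, s.1 p, LinearMap.proj q ∘ₗ s.2 ∘ₗ smallF ϖ Γ u v⟩).det
  refine (isClosed_iff _).2 ⟨Set.range minor, fun b => ?_⟩
  let y : Fin r → Γ.Lbar v := fun a => smallF ϖ Γ u v (b.basis u a)
  have heval (a g) : MvPolynomial.eval b.coord (minor (a, g)) =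
      (Matrix.of fun p q => g ((y ∘ a) p) q).det := by
    rw [RingHom.map_det]
    congr 1
    ext p q
    simp [Framed.coord, y]
  rw [Set.mem_ofPred_eq, rankVector_eq_finrank_span, ← not_lt, ← Nat.succ_le_iff,
    le_finrank_span_range_iff]
  constructor
  · rintro h _ ⟨⟨a, g⟩, rfl⟩
    by_contra hne
    rw [heval] at hne
    exact h ⟨a, linearIndependent_of_det_ne_zero hne⟩
  · rintro h ⟨a, ha⟩
    obtain ⟨g, hg⟩ := exists_det_eq_one ha
    exact one_ne_zero (hg.symm.trans ((heval a g).symm.trans (h _ ⟨⟨a, g⟩, rfl⟩)))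

end SpecialFiber

end Topology

/-! ### Strata and irreducible components -/

theorem irreducibleComponents_eq_of_isAntichain {X : Type*} [TopologicalSpace X]
    {S : Set (Set X)} (hfin : S.Finite) (hirr : ∀ Z ∈ S, IsIrreducible Z)
    (hclosed : ∀ Z ∈ S, IsClosed Z) (hdense : Dense (⋃₀ S)) (hanti : IsAntichain (· ⊆ ·) S) :
    irreducibleComponents X = S := by
  have hcover : ⋃₀ S = Set.univ := by
    rw [← hdense.closure_eq, Set.sUnion_eq_biUnion, (hfin.isClosed_biUnion hclosed).closure_eq]
  have hle {Z : Set X} (hZ : IsIrreducible Z) : ∃ Y ∈ S, Z ⊆ Y := by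
    obtain ⟨Y, hY, hZY⟩ := isIrreducible_iff_sUnion_isClosed.1 hZ hfin.toFinset
      (fun Y hY => hclosed Y (hfin.mem_toFinset.1 hY))
      (by rw [hfin.coe_toFinset, hcover]; exact Set.subset_univ Z)
    exact ⟨Y, hfin.mem_toFinset.1 hY, hZY⟩
  ext Z
  constructor
  · intro hZ
    obtain ⟨Y, hY, hZY⟩ := hle hZ.1
    rwa [hZY.antisymm (hZ.2 (hirr Y hY) hZY)]
  · refine fun hZ => ⟨hirr Z hZ, fun Z' hZ' hZZ' => ?_⟩
    obtain ⟨Y, hY, hZY⟩ := hle hZ'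
    rwa [hanti.eq hZ hY (hZZ'.trans hZY)]

theorem IsTransition.isStable_span {k ι σ : Type*} [Field k] {V : ι → Type*}
    [∀ u, AddCommGroup (V u)] [∀ u, Module k (V u)] {f : ∀ u v, V u →ₗ[k] V v} {n : ι → ι → ℤ}
    (hf : IsTransition f n) {src : σ → ι} (e : ∀ s, V (src s)) :
    IsStable f fun v => Submodule.span k (Set.range fun s => f (src s) v (e s)) := by
  intro u v
  refine Submodule.span_le (p := (Submodule.span k _).comap (f u v)).2 ?_
  rintro _ ⟨s, rfl⟩
  rw [SetLike.mem_coe, Submodule.mem_comap, hf.map_map]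
  split_ifs
  · exact Submodule.subset_span ⟨s, rfl⟩
  · exact Submodule.zero_mem _

section Components

variable {R : Type u} [CommRing R] [IsDomain R] [IsDiscreteValuationRing R]
  {K : Type w} [Field K] [Algebra R K] {ϖ : R} {d : ℕ} {ι : Type x}
  {Γ : Configuration R K d ι} {I : ι → Set ι} {r : ℕ} {t : ι → ℕ}

namespace SpecialFiber

theorem isOpen_setOf_rankVector_le_rankVector [Finite ι] (M : SpecialFiber ϖ Γ r) :
    IsOpen {N : SpecialFiber ϖ Γ r | M.rankVector ≤ N.rankVector} := by
  simp only [Pi.le_def, Set.ofPred_forall]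
  refine isOpen_iInter_of_finite fun u => isOpen_iInter_of_finite fun v => ?_
  rcases M.rankVector u v with - | m
  · simp
  · simpa only [Set.compl_ofPred, not_le, Nat.lt_iff_add_one_le] using
      (isClosed_setOf_rankVector_le (ϖ := ϖ) (Γ := Γ) (r := r) u v m).isOpen_compl

theorem finite_range_rankVector [Finite ι] :
    (Set.range (rankVector (ϖ := ϖ) (Γ := Γ) (r := r))).Finite := by
  refine (Set.Finite.pi' fun _ => Set.Finite.pi' fun _ => Set.finite_Iic r).subset ?_
  rintro _ ⟨M, rfl⟩ u v
  exact (Submodule.finrank_map_le _ _).trans (M.finrank_eq u).le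

theorem isProjective_iff_isExact [Finite ι] (H : IsLinked (smallF ϖ Γ) (exponent ϖ Γ) I)
    {M : SpecialFiber ϖ Γ r} : M.IsProjective ↔ IsExact (smallF ϖ Γ) I M.E := by
  refine ⟨fun hM => hM.isExact H, fun hM => ?_⟩
  obtain ⟨t, e, he⟩ := H.exists_isAdapted M.isStable hM
  exact he.isProjective H

theorem IsProjective.exists_isAdapted [Finite ι] (H : IsLinked (smallF ϖ Γ) (exponent ϖ Γ) I)
    {M : SpecialFiber ϖ Γ r} (hM : M.IsProjective) :
    ∃ (t : ι → ℕ) (e : ∀ s : (Σ u, Fin (t u)), Γ.Lbar s.1), IsAdapted (smallF ϖ Γ) M.E e :=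
  H.exists_isAdapted M.isStable (hM.isExact H)

theorem mem_closure_of_not_isExact [IsFractionRing R K] [Infinite (Kappa R)] [Finite ι]
    (hϖ : Irreducible ϖ)
    (hd : 0 < d) (H : IsLinked (smallF ϖ Γ) (exponent ϖ Γ) I) {M : SpecialFiber ϖ Γ r}
    (hM : ¬ IsExact (smallF ϖ Γ) I M.E) :
    M ∈ closure {N : SpecialFiber ϖ Γ r | M.rankVector < N.rankVector} := by
  obtain ⟨φ, c, a, b, hinj, hst, hrk⟩ := H.exists_deformation M.isStable
    (fun u v => (M.finrank_eq u).trans (M.finrank_eq v).symm) hM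
  obtain ⟨y, hy⟩ := M.exists_isFrame
  have hframe {s : Kappa R} (hs : 1 + s * c ≠ 0) {N : SpecialFiber ϖ Γ r}
      (hN : ∀ i, (M.E i).map (1 + s • φ i) = N.E i) :
      N.IsFrame (y + s • fun i => φ i ∘ y i) :=
    hy.map (hinj s hs) hN
  have hframe₀ : M.IsFrame (y + (0 : Kappa R) • fun i => φ i ∘ y i) := by
    rwa [zero_smul, add_zero]
  refine mem_closure_iff.2 fun W hW hMW => ?_
  have hfin := hframe₀.finite_setOf_notMem (hW.inter (isOpen_setOf_rankVector_le_rankVector M))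
    ⟨hMW, le_refl M.rankVector⟩
  have hc : {s : Kappa R | 1 + s * c = 0}.Subsingleton := by
    intro s hs s' hs'
    have hc0 : c ≠ 0 := by
      rintro rfl
      simp at hs
    exact mul_right_cancel₀ hc0 (add_left_cancel (hs.trans hs'.symm))
  obtain ⟨s, hs⟩ := (hfin.union (hc.finite.union (Set.finite_singleton 0))).exists_notMem
  simp only [Set.mem_union, not_or] at hs
  obtain ⟨hsW, (hsc : 1 + s * c ≠ 0), (hs0 : s ≠ 0)⟩ := hs
  let N : SpecialFiber ϖ Γ r := ofIsStable hϖ hd (hst s) fun i =>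
    (Submodule.equivMapOfInjective _ (hinj s hsc i) (M.E i)).finrank_eq.symm.trans (M.finrank_eq i)
  have hN : N ∈ W ∩ {N : SpecialFiber ϖ Γ r | M.rankVector ≤ N.rankVector} := by
    by_contra hN
    exact hsW ⟨N, hframe hsc fun _ => rfl, hN⟩
  have hlt : M.rankVector < N.rankVector :=
    lt_of_le_not_ge hN.2 fun h => (hrk s hs0).not_ge (h a b)
  exact ⟨N, hN.1, hlt⟩

theorem dense_setOf_isProjective [IsFractionRing R K] [Infinite (Kappa R)] [Finite ι]
    (hϖ : Irreducible ϖ) (hd : 0 < d) (H : IsLinked (smallF ϖ Γ) (exponent ϖ Γ) I) :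
    Dense {M : SpecialFiber ϖ Γ r | M.IsProjective} := by
  have hwf : WellFounded fun M N : SpecialFiber ϖ Γ r => M.rankVector > N.rankVector :=
    Set.wellFoundedOn_range.1
      ((finite_range_rankVector (ϖ := ϖ) (Γ := Γ) (r := r)).wellFoundedOn (r := (· > ·)))
  intro M
  induction M using hwf.induction with
  | _ M ih =>
    by_cases hM : IsExact (smallF ϖ Γ) I M.E
    · exact subset_closure ((isProjective_iff_isExact H).2 hM)
    · exact closure_minimal ih isClosed_closure (mem_closure_of_not_isExact hϖ hd H hM)

end SpecialFiber

namespace IsAdapted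

variable {M N : SpecialFiber ϖ Γ r}
  {e e' : ∀ s : (Σ u, Fin (t u)), Γ.Lbar s.1}

theorem rankVector_eq [Finite ι] (he : IsAdapted (smallF ϖ Γ) M.E e)
    (he' : IsAdapted (smallF ϖ Γ) N.E e') (H : IsLinked (smallF ϖ Γ) (exponent ϖ Γ) I) :
    M.rankVector = N.rankVector := by
  have := Fintype.ofFinite ι
  exact funext₂ fun u v => (he.rank_eq H u v).trans (he'.rank_eq H u v).symm

theorem of_rankVector_le [Finite ι] (he : IsAdapted (smallF ϖ Γ) M.E e)
    (H : IsLinked (smallF ϖ Γ) (exponent ϖ Γ) I) (h : M.rankVector ≤ N.rankVector) :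
    ∃ e' : ∀ s : (Σ u, Fin (t u)), Γ.Lbar s.1, IsAdapted (smallF ϖ Γ) N.E e' :=
  he.of_rank_le H M.isStable N.isStable
    (fun u => (M.finrank_eq u).trans (N.finrank_eq u).symm) h

theorem stratum_eq [Finite ι] (he : IsAdapted (smallF ϖ Γ) M.E e)
    (H : IsLinked (smallF ϖ Γ) (exponent ϖ Γ) I) :
    M.stratum = {N : SpecialFiber ϖ Γ r |
      ∃ e' : ∀ s : (Σ u, Fin (t u)), Γ.Lbar s.1, IsAdapted (smallF ϖ Γ) N.E e'} := by
  ext N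
  constructor
  · rintro ⟨α⟩
    exact he.of_iso H α.symm
  · rintro ⟨e', he'⟩
    exact he'.nonempty_iso H he

end IsAdapted

namespace SpecialFiber

theorem isFrame_iff_isAdapted {N : SpecialFiber ϖ Γ r} (q : ι → Fin r ≃ Σ u, Fin (t u))
    {e : ∀ s : (Σ u, Fin (t u)), Γ.Lbar s.1} :
    N.IsFrame (fun i a => smallF ϖ Γ _ i (e (q i a))) ↔ IsAdapted (smallF ϖ Γ) N.E e := by
  have hrange (i : ι) : Set.range (fun a => smallF ϖ Γ _ i (e (q i a))) =
      Set.range fun s => smallF ϖ Γ s.1 i (e s) :=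
    (q i).surjective.range_comp fun s => smallF ϖ Γ s.1 i (e s)
  have hiff (i : ι) := linearIndependent_equiv (R := Kappa R) (q i)
    (f := fun s => smallF ϖ Γ s.1 i (e s))
  constructor
  · intro h
    exact ⟨fun i => (hiff i).1 (h i).1, fun i => hrange i ▸ (h i).2⟩
  · intro h i
    exact ⟨(hiff i).2 (h.indep i), (hrange i).symm ▸ h.span i⟩

theorem exists_isAdapted_of_linearIndependent [IsFractionRing R K] [Finite ι]
    (hϖ : Irreducible ϖ) (hd : 0 < d) (q : ι → Fin r ≃ Σ u, Fin (t u))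
    {e : ∀ s : (Σ u, Fin (t u)), Γ.Lbar s.1}
    (he : ∀ i, LinearIndependent (Kappa R) fun s => smallF ϖ Γ s.1 i (e s)) :
    ∃ N : SpecialFiber ϖ Γ r, IsAdapted (smallF ϖ Γ) N.E e := by
  have := Fintype.ofFinite ι
  refine ⟨ofIsStable hϖ hd ((isTransition_smallF hϖ hd Γ).isStable_span e) fun i => ?_,
    he, fun i => rfl⟩
  rw [finrank_span_eq_card (he i), ← Fintype.card_congr (q i), Fintype.card_fin]

/-- Two systems of generators of the same type are joined by a line, of which almost all members
are again systems of generators of points. -/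
theorem isPreirreducible_setOf_isAdapted [IsFractionRing R K] [Infinite (Kappa R)] [Finite ι]
    (hϖ : Irreducible ϖ) (hd : 0 < d) (t : ι → ℕ) : IsPreirreducible {N : SpecialFiber ϖ Γ r |
      ∃ e : ∀ s : (Σ u, Fin (t u)), Γ.Lbar s.1, IsAdapted (smallF ϖ Γ) N.E e} := by
  have := Fintype.ofFinite ι
  rintro W₁ W₂ hW₁ hW₂ ⟨N₁, ⟨e₁, he₁⟩, hN₁⟩ ⟨N₂, ⟨e₂, he₂⟩, hN₂⟩
  have hcard (v : ι) : Fintype.card (Fin r) = Fintype.card (Σ u, Fin (t u)) := by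
    simp only [Fintype.card_fin, Fintype.card_sigma]
    rw [← he₁.finrank_eq v, N₁.finrank_eq]
  let q (v : ι) : Fin r ≃ (Σ u, Fin (t u)) := Fintype.equivOfCardEq (hcard v)
  let images (e : ∀ s : (Σ u, Fin (t u)), Γ.Lbar s.1) (i : ι) (a : Fin r) : Γ.Lbar i :=
    smallF ϖ Γ _ i (e (q i a))
  have himages (c : Kappa R) :
      images (e₁ + c • (e₂ - e₁)) = images e₁ + c • images (e₂ - e₁) := by
    ext i a
    simp only [images, Pi.add_apply, Pi.smul_apply, map_add, map_smul]
  have hframe {c : Kappa R} {N : SpecialFiber ϖ Γ r} :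
      N.IsFrame (images e₁ + c • images (e₂ - e₁)) ↔
        IsAdapted (smallF ϖ Γ) N.E (e₁ + c • (e₂ - e₁)) := by
    rw [← himages]
    exact isFrame_iff_isAdapted q
  have hframe₁ : N₁.IsFrame (images e₁ + (0 : Kappa R) • images (e₂ - e₁)) := by
    rwa [hframe, zero_smul, add_zero]
  have hframe₂ : N₂.IsFrame (images e₁ + (1 : Kappa R) • images (e₂ - e₁)) := by
    rwa [hframe, one_smul, add_sub_cancel]
  have hfin := Set.finite_iUnion fun i => finite_setOf_not_linearIndependent (hframe₁ i).1
  obtain ⟨c, hc⟩ := (hfin.union ((hframe₁.finite_setOf_notMem hW₁ hN₁).union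
    (hframe₂.finite_setOf_notMem hW₂ hN₂))).exists_notMem
  simp only [Set.mem_union, Set.mem_iUnion, not_or, not_exists] at hc
  obtain ⟨hindep, hc₁, hc₂⟩ := hc
  obtain ⟨N, hN⟩ := exists_isAdapted_of_linearIndependent hϖ hd q
    (e := e₁ + c • (e₂ - e₁)) fun i => by
      have hi := not_not.1 (hindep i)
      rw [← Pi.smul_apply, ← Pi.add_apply, ← himages] at hi
      exact (linearIndependent_equiv (q i)).1 hi
  refine ⟨N, ⟨_, hN⟩, ?_, ?_⟩
  · by_contra h
    exact hc₁ ⟨N, hframe.2 hN, h⟩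
  · by_contra h
    exact hc₂ ⟨N, hframe.2 hN, h⟩

theorem isProjective_iff_maximal [IsFractionRing R K] [Infinite (Kappa R)] [Finite ι]
    (hϖ : Irreducible ϖ)
    (hd : 0 < d) (H : IsLinked (smallF ϖ Γ) (exponent ϖ Γ) I) (M : SpecialFiber ϖ Γ r) :
    M.IsProjective ↔
      Maximal (· ∈ Set.range (rankVector (ϖ := ϖ) (Γ := Γ) (r := r))) M.rankVector := by
  constructor
  · intro hM
    refine ⟨⟨M, rfl⟩, ?_⟩
    rintro _ ⟨N, rfl⟩ hle
    obtain ⟨t, e, he⟩ := hM.exists_isAdapted H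
    obtain ⟨e', he'⟩ := he.of_rankVector_le H hle
    exact (he.rankVector_eq he' H).ge
  · intro hM
    by_contra hproj
    rw [isProjective_iff_isExact H] at hproj
    obtain ⟨N, hN⟩ := closure_nonempty_iff.1 ⟨M, mem_closure_of_not_isExact hϖ hd H hproj⟩
    exact hN.not_ge (hM.2 ⟨N, rfl⟩ hN.le)

theorem mem_stratum (M : SpecialFiber ϖ Γ r) : M ∈ M.stratum := ⟨Iso.refl _⟩

theorem stratum_eq_of_mem {M N : SpecialFiber ϖ Γ r} (h : N ∈ M.stratum) :
    N.stratum = M.stratum := by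
  obtain ⟨α⟩ := h
  ext N'
  exact ⟨fun ⟨β⟩ => ⟨β ≪≫ α⟩, fun ⟨β⟩ => ⟨β ≪≫ α.symm⟩⟩

theorem IsProjective.isIrreducible_stratum [IsFractionRing R K] [Infinite (Kappa R)] [Finite ι]
    (hϖ : Irreducible ϖ)
    (hd : 0 < d) (H : IsLinked (smallF ϖ Γ) (exponent ϖ Γ) I) {M : SpecialFiber ϖ Γ r}
    (hM : M.IsProjective) : IsIrreducible M.stratum := by
  obtain ⟨t, e, he⟩ := hM.exists_isAdapted H
  refine ⟨⟨M, M.mem_stratum⟩, ?_⟩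
  rw [he.stratum_eq H]
  exact isPreirreducible_setOf_isAdapted hϖ hd t

theorem IsProjective.stratum_eq [Finite ι] (H : IsLinked (smallF ϖ Γ) (exponent ϖ Γ) I)
    {M : SpecialFiber ϖ Γ r} (hM : M.IsProjective) :
    M.stratum = {N : SpecialFiber ϖ Γ r | M.rankVector ≤ N.rankVector} := by
  obtain ⟨t, e, he⟩ := hM.exists_isAdapted H
  rw [he.stratum_eq H]
  ext N
  exact ⟨fun ⟨_, he'⟩ => (he.rankVector_eq he' H).le, he.of_rankVector_le H⟩

theorem IsProjective.mem_stratum_of_mem_closure [Finite ι]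
    (H : IsLinked (smallF ϖ Γ) (exponent ϖ Γ) I) {M N : SpecialFiber ϖ Γ r}
    (hM : M.IsProjective) (h : M ∈ closure N.stratum) : N ∈ M.stratum := by
  have hopen : IsOpen M.stratum := hM.stratum_eq H ▸ isOpen_setOf_rankVector_le_rankVector M
  obtain ⟨N', hM', hN'⟩ := mem_closure_iff.1 h _ hopen M.mem_stratum
  rw [← stratum_eq_of_mem hM', stratum_eq_of_mem hN']
  exact N.mem_stratum

theorem finite_setOf_closure_stratum [Finite ι] (H : IsLinked (smallF ϖ Γ) (exponent ϖ Γ) I) :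
    {Z | ∃ M : SpecialFiber ϖ Γ r, M.IsProjective ∧ Z = closure M.stratum}.Finite := by
  refine ((finite_range_rankVector (ϖ := ϖ) (Γ := Γ) (r := r)).image fun v =>
    closure {N : SpecialFiber ϖ Γ r | v ≤ N.rankVector}).subset ?_
  rintro _ ⟨M, hM, rfl⟩
  exact ⟨M.rankVector, ⟨M, rfl⟩, (congrArg closure (hM.stratum_eq H)).symm⟩

theorem irreducibleComponents_eq [IsFractionRing R K] [Infinite (Kappa R)] [Finite ι]
    (hϖ : Irreducible ϖ) (hd : 0 < d) (H : IsLinked (smallF ϖ Γ) (exponent ϖ Γ) I) :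
    irreducibleComponents (SpecialFiber ϖ Γ r) =
      {Z | ∃ M : SpecialFiber ϖ Γ r, M.IsProjective ∧ Z = closure M.stratum} := by
  refine irreducibleComponents_eq_of_isAntichain (finite_setOf_closure_stratum H) ?_ ?_ ?_ ?_
  · rintro _ ⟨M, hM, rfl⟩
    exact (hM.isIrreducible_stratum hϖ hd H).closure
  · rintro _ ⟨M, -, rfl⟩
    exact isClosed_closure
  · exact (dense_setOf_isProjective hϖ hd H).mono fun M hM =>
      ⟨_, ⟨M, hM, rfl⟩, subset_closure M.mem_stratum⟩
  · rintro _ ⟨M, hM, rfl⟩ _ ⟨N, -, rfl⟩ hne hMN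
    have hmem := hM.mem_stratum_of_mem_closure H (hMN (subset_closure M.mem_stratum))
    exact hne (congrArg closure (stratum_eq_of_mem hmem).symm)

end SpecialFiber

end Components

end LinkedGrassmannian

theorem mainTheorem4_general
    {R : Type u} [CommRing R] [IsDomain R] [IsDiscreteValuationRing R]
    [Infinite (IsLocalRing.ResidueField R)]
    {K : Type w} [Field K] [Algebra R K] [IsFractionRing R K]
    {ϖ : R} (hϖ : Irreducible ϖ)
    {d r : ℕ} (hd : 0 < d)
    {ι : Type x} [Finite ι] {Γ : LinkedGrassmannian.Configuration R K d ι}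
    (hΓ : LinkedGrassmannian.IsLocallyWeaklyIndependent ϖ Γ) :
    Dense {M : LinkedGrassmannian.SpecialFiber ϖ Γ r | M.IsProjective} ∧
    (∀ M : LinkedGrassmannian.SpecialFiber ϖ Γ r,
      M.IsProjective ↔
        Maximal (· ∈ Set.range
          (LinkedGrassmannian.SpecialFiber.rankVector (ϖ := ϖ) (Γ := Γ) (r := r)))
          M.rankVector) ∧
    irreducibleComponents (LinkedGrassmannian.SpecialFiber ϖ Γ r) =
      {Z | ∃ M : LinkedGrassmannian.SpecialFiber ϖ Γ r, M.IsProjective ∧ Z = closure M.stratum} ∧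
    (∀ M N : LinkedGrassmannian.SpecialFiber ϖ Γ r, M.IsProjective →
      closure M.stratum = closure N.stratum → Nonempty (M.rep ≅ N.rep)) := by
  obtain ⟨I, H⟩ := hΓ.exists_isLinked hϖ hd
  refine ⟨LinkedGrassmannian.SpecialFiber.dense_setOf_isProjective hϖ hd H,
    LinkedGrassmannian.SpecialFiber.isProjective_iff_maximal hϖ hd H,
    LinkedGrassmannian.SpecialFiber.irreducibleComponents_eq hϖ hd H, fun M N hM h => ?_⟩
  obtain ⟨α⟩ := hM.mem_stratum_of_mem_closure H (h ▸ subset_closure M.mem_stratum)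
  exact ⟨α.symm⟩

theorem mainTheorem4
    {R : Type u} [CommRing R] [IsDomain R] [IsDiscreteValuationRing R]
    [IsAlgClosed (IsLocalRing.ResidueField R)]
    {K : Type w} [Field K] [Algebra R K] [IsFractionRing R K]
    (ϖ : R) (hϖ : Irreducible ϖ)
    {d r : ℕ} (hr : 0 < r) (hrd : r < d)
    {ι : Type x} [Finite ι] (Γ : LinkedGrassmannian.Configuration R K d ι)
    (hΓ : LinkedGrassmannian.IsLocallyWeaklyIndependent ϖ Γ) :
    Dense {M : LinkedGrassmannian.SpecialFiber ϖ Γ r | M.IsProjective} ∧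
    (∀ M : LinkedGrassmannian.SpecialFiber ϖ Γ r,
      M.IsProjective ↔
        Maximal (· ∈ Set.range
          (LinkedGrassmannian.SpecialFiber.rankVector (ϖ := ϖ) (Γ := Γ) (r := r)))
          M.rankVector) ∧
    irreducibleComponents (LinkedGrassmannian.SpecialFiber ϖ Γ r) =
      {Z | ∃ M : LinkedGrassmannian.SpecialFiber ϖ Γ r, M.IsProjective ∧ Z = closure M.stratum} ∧
    (∀ M N : LinkedGrassmannian.SpecialFiber ϖ Γ r, M.IsProjective → N.IsProjective →
      closure M.stratum = closure N.stratum → Nonempty (M.rep ≅ N.rep)) :=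
  have h := mainTheorem4_general (r := r) hϖ (hr.trans hrd) hΓ
  ⟨h.1, h.2.1, h.2.2.1, fun M N hM _ => h.2.2.2 M N hM⟩
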